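/- **Setting.** Let $E$ be a compact metric space and $q\in\mathbb N$. Let $\Omega=D([0,\infty);E)\times D([0,\infty);\mathbb R^q)$ be the product of the spaces of càdlàg paths, with the $\sigma$-algebra generated by the coordinate maps $X_t(x,y)=x(t)$ and $Y_t(x,y)=y(t)$ (the Borel $\sigma$-algebra of the Skorokhod topology). A hidden Markov model consists of a semigroup $(T_t)_{t\ge0}$ of Markov transition kernels on $E\times\mathbb R^q$ with $T_0=\mathrm{Id}$ and a family $\{\mathbf P^\mu:\mu\in\mathcal P(E)\}$ of probability measures on $\Omega$ indexed by the Borel probability measures $\mu$ on $E$, such that for all bounded measurable $f$, all $\mu\in\mathcal P(E)$ and all $s,t\ge 0$: * $\mathbf P^\mu(f(X_{s+t},Y_{s+t})\mid\mathcal F_s)=(T_tf)(X_s,Y_s)$, where $(\mathcal F_s)$ is the usual augmentation of $\sigma\{X_r,Y_r:r\le s\}$ with respect to the family $\{\mathbf P^\mu\}$ (complete for each member, then intersect over $\mu$, and make right-continuous); * $\mathbf P^\mu(f(X_t,Y_t))=\int (T_tf)(x,0)\,\mu(dx)$, i.e. the initial law is $\mu\otimes\delta_0$; * (Markov additivity)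 $(T_tS_yf)(x,y)$ does not depend on $y$, where $(S_yf)(x,z)=f(x,z-y)$. The pair $(X,Y)$ is *Feller* if $T_t$ maps $C_0(E\times\mathbb R^q)$ into itself for all $t$ and $\|T_tf-f\|_\infty\to0$ as $t\downarrow0$ for every $f\in C_0(E\times\mathbb R^q)$. Let $\mathcal F^Y=\sigma\{Y_t:t\ge0\}$, and let $(\mathcal F^Y_t)$ be the usual augmentation of $\sigma\{Y_s:s\le t\}$ with respect to $\{\mathbf P^\mu\}$. Write $\|\cdot\|_{\mathrm{TV}}$ for the total variation distance and $\|\mu-\nu\|_{\mathrm{BL}}=\sup\{|\int f\,d\mu-\int f\,d\nu|:\ |f|\le1,\ f \text{ is }1\text{-Lipschitz}\}$. A *filter* for $\mu$ is a $\mathcal P(E)$-valued process $(\pi^\mu_t)_{t\ge0}$ on $\Omega$ whose paths are càdlàg in the weak topology and such that, for every $t$ and every Borel set $A$, $\pi^\mu_t(A)$ is $\mathcal F^Y_t$-measurable and is a version of $\mathbf P^\mu(X_t\in A\mid\mathcal F^Y_t)$. **Proposition 3.5.** Suppose that $E$ is compact, that $(X,Y)$ is Feller, and that the model is observable: $\mathbf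 P^\mu|_{\mathcal F^Y}=\mathbf P^\nu|_{\mathcal F^Y}$ implies $\mu=\nu$. Then the model is uniformly observable: for all sequences $(\mu_n),(\nu_n)$ in $\mathcal P(E)$, $$\big\|\mathbf P^{\mu_n}|_{\mathcal F^Y}-\mathbf P^{\nu_n}|_{\mathcal F^Y}\big\|_{\mathrm{TV}}\to0\quad\text{implies}\quad\|\mu_n-\nu_n\|_{\mathrm{BL}}\to0 .$$ Consequently the filter is stable: if $\mu,\nu\in\mathcal P(E)$ satisfy $\mathbf P^\mu|_{\mathcal F^Y}\ll\mathbf P^\nu|_{\mathcal F^Y}$, then for all filters $\pi^\mu$ for $\mu$ and $\pi^\nu$ for $\nu$, $$\|\pi^\mu_t-\pi^\nu_t\|_{\mathrm{BL}}\xrightarrow[t\to\infty]{}0\qquad \mathbf P^\mu\text{-a.s.}$$ -/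

import Mathlib

open MeasureTheory ProbabilityTheory Filter Topology Set
open scoped NNReal ENNReal ZeroAtInfty

noncomputable section

namespace HMM

/-- A function on the half-line of times `[0, ∞)` is càdlàg: it is continuous from the right at
every time and has a limit from the left at every time. (At time `0` the filter `𝓝[<] 0` is
trivial, so the second clause says nothing there.) -/
def IsCadlag {S : Type*} [TopologicalSpace S] (x : ℝ≥0 → S) : Prop :=
  ∀ t : ℝ≥0, ContinuousWithinAt x (Ioi t) t ∧ ∃ l : S, Tendsto x (𝓝[<] t) (𝓝 l)

/-- The space `D([0, ∞); S)` of càdlàg paths with values in `S`. -/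
def CadlagPath (S : Type*) [TopologicalSpace S] : Type _ := {x : ℝ≥0 → S // IsCadlag x}

/-- The coordinate projection of the path space at time `t`. -/
def CadlagPath.coord {S : Type*} [TopologicalSpace S] (t : ℝ≥0) (x : CadlagPath S) : S := x.1 t

/-- The path space carries the σ-algebra generated by all coordinate projections; for a Polish
space `S` it is the Borel σ-algebra of the Skorokhod topology. -/
instance CadlagPath.instMeasurableSpace {S : Type*} [TopologicalSpace S] [MeasurableSpace S] :
    MeasurableSpace (CadlagPath S) :=
  ⨆ t : ℝ≥0, MeasurableSpace.comap (CadlagPath.coord t) inferInstance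

/-- The distance `‖μ - ν‖_G = sup_{g ∈ G} |∫ g dμ - ∫ g dν|` for a class `G` of functions. It is
used for (probability measures and) nonempty uniformly bounded classes of measurable functions,
where the supremum is finite. -/
def dualDist {S : Type*} [MeasurableSpace S] (G : Set (S → ℝ)) (μ ν : Measure S) : ℝ :=
  sSup ((fun g : S → ℝ => |∫ x, g x ∂μ - ∫ x, g x ∂ν|) '' G)

/-- `Lip(S)`: the functions bounded by one in absolute value and Lipschitz with constant one. -/
def lipUnitBall (S : Type*) [MetricSpace S] : Set (S → ℝ) :=
  {g | (∀ x, |g x| ≤ 1) ∧ LipschitzWith 1 g}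

/-- The dual bounded-Lipschitz distance `‖μ - ν‖_BL`. -/
def blDist {S : Type*} [MetricSpace S] [MeasurableSpace S] (μ ν : Measure S) : ℝ :=
  dualDist (lipUnitBall S) μ ν

/-- The total variation distance `‖μ - ν‖_TV`: the supremum of `|∫ g dμ - ∫ g dν|` over all
measurable functions `g` with `|g| ≤ 1`. -/
def tvDist {S : Type*} [MeasurableSpace S] (μ ν : Measure S) : ℝ :=
  dualDist {g : S → ℝ | Measurable g ∧ ∀ x, |g x| ≤ 1} μ ν

/-- `B(S)`: the bounded measurable real functions on `S`. -/
def IsBoundedMeasurable {S : Type*} [MeasurableSpace S] (f : S → ℝ) : Prop :=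
  Measurable f ∧ ∃ C : ℝ, ∀ x, |f x| ≤ C

/-- The operator `f ↦ (p ↦ ∫ f dκ(p))` on functions that belongs to a kernel `κ`. -/
def kernelOp {S : Type*} [MeasurableSpace S] (κ : Kernel S S) (f : S → ℝ) (p : S) : ℝ :=
  ∫ z, f z ∂(κ p)

/-- The usual augmentation of a filtration `F` with respect to a family `P` of measures: for each
member of the family all its null sets are added, one intersects over the family, and the
resulting filtration is made right-continuous. (In Lean `P i N = 0` is meaningful for every set
`N`; it says that `N` is contained in a measurable set of measure zero.) -/
@[reducible] def usualAugmentation {Ω ι : Type*} [MeasurableSpace Ω] (P : ι → Measure Ω)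
    (F : ℝ≥0 → MeasurableSpace Ω) (t : ℝ≥0) : MeasurableSpace Ω :=
  ⨅ s : ℝ≥0, ⨅ _ : t < s, ⨅ i : ι, F s ⊔ MeasurableSpace.generateFrom {N | P i N = 0}

/-- The observation state space `ℝ^q`. -/
abbrev ObsSpace (q : ℕ) : Type := EuclideanSpace ℝ (Fin q)

/-- The canonical space `Ω = D([0, ∞); E) × D([0, ∞); ℝ^q)`, with the product σ-algebra. -/
abbrev PathSpace (E : Type*) [TopologicalSpace E] (q : ℕ) : Type _ :=
  CadlagPath E × CadlagPath (ObsSpace q)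

section Canonical

variable {E : Type*} [TopologicalSpace E] {q : ℕ}

/-- The signal `X_t`. -/
def sig (t : ℝ≥0) (ω : PathSpace E q) : E := ω.1.coord t

/-- The observation `Y_t`. -/
def obs (t : ℝ≥0) (ω : PathSpace E q) : ObsSpace q := ω.2.coord t

variable (E q) in
/-- The natural filtration of the signal, `σ{X_s : s ≤ t}`. -/
@[reducible] def sigFiltration [MeasurableSpace E] (t : ℝ≥0) : MeasurableSpace (PathSpace E q) :=
  ⨆ s : ℝ≥0, ⨆ _ : s ≤ t, MeasurableSpace.comap (sig s) inferInstance

variable (E q) in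
/-- The natural filtration of the observations, `σ{Y_s : s ≤ t}`. -/
@[reducible] def obsFiltration (t : ℝ≥0) : MeasurableSpace (PathSpace E q) :=
  ⨆ s : ℝ≥0, ⨆ _ : s ≤ t, MeasurableSpace.comap (obs s) inferInstance

variable (E q) in
/-- The natural filtration of the pair, `σ{X_s, Y_s : s ≤ t}`. -/
@[reducible] def pairFiltration [MeasurableSpace E] (t : ℝ≥0) : MeasurableSpace (PathSpace E q) :=
  sigFiltration E q t ⊔ obsFiltration E q t

end Canonical

/-- The translation operator `(S_y f)(x, z) = f (x, z - y)`. -/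
def obsTranslate {E : Type*} {q : ℕ} (y : ObsSpace q) (f : E × ObsSpace q → ℝ) :
    E × ObsSpace q → ℝ :=
  fun p => f (p.1, p.2 - y)

/-- A continuous-time hidden Markov model with signal state space `E` and observation state space
`ℝ^q` on the canonical path space. -/
structure HiddenMarkovModel (E : Type*) [TopologicalSpace E] [MeasurableSpace E] (q : ℕ) where
  /-- The transition kernels of the pair `(X, Y)`; `T_t f = kernelOp (trans t) f`. -/
  trans : ℝ≥0 → Kernel (E × ObsSpace q) (E × ObsSpace q)
  markovKernel : ∀ t, IsMarkovKernel (trans t)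
  trans_zero : trans 0 = Kernel.id
  /-- The semigroup property `T_{s+t} = T_s T_t`. -/
  trans_add : ∀ (s t : ℝ≥0) (f : E × ObsSpace q → ℝ), IsBoundedMeasurable f →
    kernelOp (trans (s + t)) f = kernelOp (trans s) (kernelOp (trans t) f)
  /-- The law `P^μ` on path space, for each initial law `μ` of the signal. -/
  law : ProbabilityMeasure E → Measure (PathSpace E q)
  isProbabilityMeasure_law : ∀ μ, IsProbabilityMeasure (law μ)
  /-- Markov property: `P^μ(f(X_{s+t}, Y_{s+t}) | F_s) = (T_t f)(X_s, Y_s)`, where `F_s` is the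
  usual augmentation of the natural filtration of the pair with respect to all the laws. -/
  markov : ∀ (μ : ProbabilityMeasure E) (s t : ℝ≥0) (f : E × ObsSpace q → ℝ),
    IsBoundedMeasurable f →
    ∀ B : Set (PathSpace E q), MeasurableSet[usualAugmentation law (pairFiltration E q) s] B →
      ∫ ω in B, f (sig (s + t) ω, obs (s + t) ω) ∂(law μ)
        = ∫ ω in B, kernelOp (trans t) f (sig s ω, obs s ω) ∂(law μ)
  /-- The initial law is `μ ⊗ δ_0`, so that `P^μ(f(X_t, Y_t)) = ∫ (T_t f)(x, 0) μ(dx)`. -/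
  marginal : ∀ (μ : ProbabilityMeasure E) (t : ℝ≥0) (f : E × ObsSpace q → ℝ),
    IsBoundedMeasurable f →
    ∫ ω, f (sig t ω, obs t ω) ∂(law μ)
      = ∫ x, kernelOp (trans t) f (x, 0) ∂(μ : Measure E)
  /-- Markov additivity: `(T_t S_y f)(x, y)` does not depend on `y`. -/
  additive : ∀ (t : ℝ≥0) (f : E × ObsSpace q → ℝ), IsBoundedMeasurable f →
    ∀ (x : E) (y y₂ : ObsSpace q),
      kernelOp (trans t) (obsTranslate y f) (x, y) = kernelOp (trans t) (obsTranslate y₂ f) (x, y₂)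

namespace HiddenMarkovModel

variable {E : Type*} {q : ℕ}

/-- `(X, Y)` is Feller: its semigroup maps `C₀(E × ℝ^q)` into itself and is strongly continuous
there, that is, `T_t f → f` uniformly as `t → 0` for every `f` in `C₀(E × ℝ^q)`. -/
structure IsFeller [TopologicalSpace E] [MeasurableSpace E] (M : HiddenMarkovModel E q) :
    Prop where
  mapsTo : ∀ (t : ℝ≥0) (f : C₀(E × ObsSpace q, ℝ)),
    ∃ g : C₀(E × ObsSpace q, ℝ), ∀ p, g p = kernelOp (M.trans t) f p
  strongCont : ∀ f : C₀(E × ObsSpace q, ℝ),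
    TendstoUniformly (fun (t : ℝ≥0) p => kernelOp (M.trans t) f p) f (𝓝 0)

/-- The law of the whole observation process `(Y_t)_{t ≥ 0}` under `P^μ`, that is, the restriction
of `P^μ` to the σ-algebra generated by the observations, as a measure on `D([0, ∞); ℝ^q)`. -/
def obsLaw [TopologicalSpace E] [MeasurableSpace E] (M : HiddenMarkovModel E q)
    (μ : ProbabilityMeasure E) : Measure (CadlagPath (ObsSpace q)) :=
  (M.law μ).map Prod.snd

/-- Observability: the law of the observation process determines the initial law. -/
def Observable [TopologicalSpace E] [MeasurableSpace E] (M : HiddenMarkovModel E q) : Prop :=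
  ∀ μ ν : ProbabilityMeasure E, M.obsLaw μ = M.obsLaw ν → μ = ν

/-- `G`-uniform observability: for all sequences of initial laws, merging of the laws of the
observation process in total variation implies merging of the initial laws in `‖·‖_G`. -/
def UniformlyObservableFor [TopologicalSpace E] [MeasurableSpace E]
    (M : HiddenMarkovModel E q) (G : Set (E → ℝ)) : Prop :=
  ∀ μ ν : ℕ → ProbabilityMeasure E,
    Tendsto (fun n => tvDist (M.obsLaw (μ n)) (M.obsLaw (ν n))) atTop (𝓝 0) →
    Tendsto (fun n => dualDist G (μ n : Measure E) (ν n : Measure E)) atTop (𝓝 0)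

/-- Uniform observability: the case `G = Lip(E)`. -/
def UniformlyObservable [MetricSpace E] [MeasurableSpace E] (M : HiddenMarkovModel E q) : Prop :=
  M.UniformlyObservableFor (lipUnitBall E)

/-- The usual augmentation `F^Y_t` of the natural filtration of the observations, with respect to
the family of all the laws `P^μ`. -/
@[reducible] def augObsFiltration [TopologicalSpace E] [MeasurableSpace E] (M : HiddenMarkovModel E q)
    (t : ℝ≥0) : MeasurableSpace (PathSpace E q) :=
  usualAugmentation M.law (obsFiltration E q) t

/-- `π` is (a version of) the nonlinear filter for the initial law `μ`: a process of probability
measures on `E`, càdlàg in the topology of weak convergence, such that `π_t` is a regular version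
of the conditional law `P^μ(X_t ∈ · | F^Y_t)` for every `t`. -/
structure IsFilter [TopologicalSpace E] [MeasurableSpace E] [OpensMeasurableSpace E]
    (M : HiddenMarkovModel E q) (μ : ProbabilityMeasure E)
    (π : ℝ≥0 → PathSpace E q → ProbabilityMeasure E) : Prop where
  cadlag : ∀ ω, IsCadlag fun t => π t ω
  adapted : ∀ (t : ℝ≥0) (A : Set E), MeasurableSet A →
    Measurable[M.augObsFiltration t] fun ω => (π t ω : Measure E) A
  condLaw : ∀ (t : ℝ≥0) (A : Set E), MeasurableSet A →
    ∀ B : Set (PathSpace E q), MeasurableSet[M.augObsFiltration t] B →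
      ∫⁻ ω in B, (π t ω : Measure E) A ∂(M.law μ) = M.law μ (B ∩ sig t ⁻¹' A)

end HiddenMarkovModel

end HMM

end

/-! Everything rests on predictions. For bounded continuous `g i`, the product of the `g i (Y_{t+i}
- Y_t)` over a finite set of times has conditional expectation `u (X_t)` given the past, with one
continuous `u` on `E` serving every time and every initial law. The Markov property and additivity
give the form `u (X_t)`; the Feller property gives continuity. At time zero, where `Y_0 = 0`, this
says that the observation law of `κ` integrates the product to `∫ u dκ`. See
`IsFeller.exists_setIntegral_prod_eq` and `IsFeller.exists_isPrediction`.

Such products determine the observation law. If the integrals of all predictions merge for two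
families of initial laws, then weak limit points of the two families along a common ultrafilter have
the same observation law, and observability makes them equal. Since the probability measures on `E`
are compact and Arzelà–Ascoli turns weak convergence into bounded-Lipschitz convergence, the
families merge (`IsFeller.tendsto_blDist_of_predictions`). Total variation merging of the
observation laws supplies the hypothesis, so uniform observability follows.

Stability applies the same deterministic criterion path by path to the two filters. Integrated
against the filter, `u` becomes the conditional expectation of one functional of future
observations, under `P^μ` or under `P^ν`. These forecasts merge by a Blackwell–Dubins argument: the
likelihood ratio on the observations is close in `L¹` to a function of finitely much past, which
does not affect later forecasts; `maximal_inequality` makes this uniform in time. Separability of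
the continuous functions on `E` leaves countably many exceptional null sets. -/

noncomputable section

open scoped BoundedContinuousFunction

namespace HMM

/-! ### Augmented σ-algebras and measurability modulo null sets -/

section Augmentation

variable {Ω ι : Type*} {m m₀ : MeasurableSpace Ω}

/-- The usual augmentation is contained, modulo null sets of each member of the family, in any
σ-algebra which contains the whole filtration. -/
lemma usualAugmentation_le {P : ι → Measure Ω} {F : ℝ≥0 → MeasurableSpace Ω}
    (hF : ∀ t, F t ≤ m) (t : ℝ≥0) (i : ι) :
    usualAugmentation P F t ≤ eventuallyMeasurableSpace m (ae (P i)) := by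
  have h1 : usualAugmentation P F t
      ≤ F (t + 1) ⊔ MeasurableSpace.generateFrom {N | P i N = 0} :=
    iInf_le_of_le (t + 1) (iInf_le_of_le (lt_add_one t) (iInf_le _ i))
  refine h1.trans (sup_le ((hF _).trans le_eventuallyMeasurableSpace) ?_)
  refine MeasurableSpace.generateFrom_le fun N hN => ?_
  refine ⟨∅, @MeasurableSet.empty _ m, ?_⟩
  exact ae_eq_empty.2 hN

lemma usualAugmentation_mono_time {P : ι → Measure Ω} {F : ℝ≥0 → MeasurableSpace Ω}
    {s t : ℝ≥0} (hst : s ≤ t) : usualAugmentation P F s ≤ usualAugmentation P F t :=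
  le_iInf₂ fun r hr => iInf₂_le_of_le r (hst.trans_lt hr) le_rfl

lemma usualAugmentation_mono {P : ι → Measure Ω} {F G : ℝ≥0 → MeasurableSpace Ω}
    (hFG : ∀ t, F t ≤ G t) (t : ℝ≥0) : usualAugmentation P F t ≤ usualAugmentation P G t :=
  iInf₂_mono fun r _ => iInf_mono fun _ => sup_le_sup_right (hFG r) _

lemma le_usualAugmentation {P : ι → Measure Ω} {F : ℝ≥0 → MeasurableSpace Ω} (hF : Monotone F)
    (t : ℝ≥0) : F t ≤ usualAugmentation P F t :=
  le_iInf₂ fun _ hr => le_iInf fun _ => (hF hr.le).trans le_sup_left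

/-- A real function which is measurable modulo null sets with respect to `m` is almost everywhere
equal to an `m`-measurable one. -/
lemma aestronglyMeasurable_of_eventuallyMeasurable {P : Measure Ω}
    {f : Ω → ℝ} (hf : Measurable[eventuallyMeasurableSpace m (ae P)] f) :
    AEStronglyMeasurable[m] f P := by
  classical
  have h : ∀ r : ℚ, ∃ A, MeasurableSet[m] A ∧ f ⁻¹' Iio (r : ℝ) =ᵐ[P] A := fun r =>
    hf measurableSet_Iio
  choose A hA hfA using h
  -- `f` is the infimum of the rationals `r` with `f < r`. Replacing the level sets by their
  -- `m`-measurable versions gives the candidate; the value `⊤` discards the other `r`, and `EReal`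
  -- keeps the infimum defined on the null set where the versions disagree.
  let S : ℚ → Ω → EReal := fun r ω => if ω ∈ A r then ((r : ℝ) : EReal) else ⊤
  have hS : ∀ r, Measurable[m] (S r) := fun r =>
    Measurable.ite (m := m) (hA r) (measurable_const) (measurable_const)
  have hI : Measurable[m] fun ω => ⨅ r, S r ω := Measurable.iInf hS
  refine ⟨fun ω => (⨅ r, S r ω).toReal,
    (measurable_ereal_toReal.comp hI).stronglyMeasurable, ?_⟩
  filter_upwards [ae_all_iff.2 fun r => (hfA r).mem_iff] with ω hω
  have : (⨅ r, S r ω) = (f ω : EReal) := by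
    refine le_antisymm ?_ ?_
    · refine le_of_forall_gt_imp_ge_of_dense fun c hc => ?_
      obtain ⟨r, hr1, hr2⟩ := EReal.lt_iff_exists_rat_btwn.1 hc
      refine (iInf_le _ r).trans ?_
      have : ω ∈ A r := (hω r).1 (by simpa using hr1)
      simp only [S, this, if_true]
      exact hr2.le
    · refine le_iInf fun r => ?_
      by_cases hr : ω ∈ A r
      · have h2 : f ω < r := by simpa using (hω r).2 hr
        simp only [S, hr, if_true]
        exact_mod_cast h2.le
      · simp [S, hr]
  simp [this]

/-- Augmented σ-algebras need not lie inside `m₀`, so their events enter integrals only as null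
measurable sets. -/
lemma nullMeasurableSet_of_eventuallyMeasurableSet (hm : m ≤ m₀)
    {P : Measure Ω} {B : Set Ω}
    (hB : MeasurableSet[eventuallyMeasurableSpace m (ae P)] B) :
    NullMeasurableSet B P := by
  obtain ⟨A, hA, hBA⟩ := hB
  exact NullMeasurableSet.congr (hm _ hA).nullMeasurableSet hBA.symm

/-- A function with zero integral over all sets of a σ-algebra is orthogonal to the functions
measurable with respect to this σ-algebra. -/
lemma integral_mul_eq_zero_of_forall_setIntegral_eq_zero (hm : m ≤ m₀)
    {κ : Measure Ω} [IsFiniteMeasure κ] {H D : Ω → ℝ} (hH : StronglyMeasurable[m] H)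
    (hD : Integrable D κ) (hHD : Integrable (H * D) κ)
    (h0 : ∀ C, MeasurableSet[m] C → ∫ ω in C, D ω ∂κ = 0) : ∫ ω, H ω * D ω ∂κ = 0 := by
  have h1 : (0 : Ω → ℝ) =ᵐ[κ] κ[D | m] :=
    ae_eq_condExp_of_forall_setIntegral_eq hm hD (fun _ _ _ => integrableOn_zero)
      (fun s hs _ => by simp [h0 s hs]) aestronglyMeasurable_zero
  have h2 : κ[H * D | m] =ᵐ[κ] H * κ[D | m] := condExp_mul_of_stronglyMeasurable_left hH hHD hD
  calc ∫ ω, H ω * D ω ∂κ = ∫ ω, (κ[H * D | m]) ω ∂κ := (integral_condExp hm).symm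
    _ = ∫ ω, (0 : ℝ) ∂κ := by
      refine integral_congr_ae ?_
      filter_upwards [h1, h2] with ω h1 h2
      rw [h2, Pi.mul_apply, ← h1]; simp
    _ = 0 := by simp

end Augmentation

/-! ### Laws of processes and the σ-algebras on path space -/

section Laws

/-- Finite measures on a space carrying the σ-algebra of a process are equal if the integrals of
products of bounded continuous functions of the process agree. -/
lemma ext_of_forall_integral_prod_process {Ω T S : Type*} [mΩ : MeasurableSpace Ω]
    [TopologicalSpace S] [MeasurableSpace S] [BorelSpace S] [HasOuterApproxClosed S]
    (V : T → Ω → S) (hV : mΩ = ⨆ t, MeasurableSpace.comap (V t) inferInstance)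
    {P Q : Measure Ω} [IsFiniteMeasure P] [IsFiniteMeasure Q]
    (h : ∀ (I : Finset T) (f : T → (S →ᵇ ℝ)),
      ∫ ω, ∏ i ∈ I, f i (V i ω) ∂P = ∫ ω, ∏ i ∈ I, f i (V i ω) ∂Q) : P = Q := by
  classical
  have hVm : ∀ t, Measurable (V t) := fun t => by
    rw [measurable_iff_comap_le, hV]
    exact le_iSup (fun t => MeasurableSpace.comap (V t) inferInstance) t
  have hVm' : Measurable (fun ω t => V t ω) := measurable_pi_lambda _ hVm
  have hcomap : mΩ = MeasurableSpace.comap (fun ω t => V t ω) MeasurableSpace.pi := by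
    rw [hV, MeasurableSpace.pi, MeasurableSpace.comap_iSup]
    simp_rw [MeasurableSpace.comap_comp]
    rfl
  have hmap : P.map (fun ω t => V t ω) = Q.map (fun ω t => V t ω) := by
    have hI : ∀ I : Finset T, (P.map (fun ω t => V t ω)).map I.restrict
        = (Q.map (fun ω t => V t ω)).map I.restrict := by
      intro I
      have hr : Measurable (fun ω => I.restrict (fun t => V t ω)) :=
        (Finset.measurable_restrict I).comp hVm'
      rw [Measure.map_map (Finset.measurable_restrict I) hVm',
        Measure.map_map (Finset.measurable_restrict I) hVm']
      -- The uniqueness criterion used for `key` concerns a finite product times one further factor;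
      -- the one-point space fills that place and is projected away afterwards.
      have hu : Measurable (fun ω => ((I.restrict (fun t => V t ω), ()) : (I → S) × Unit)) :=
        hr.prodMk measurable_const
      let _ : TopologicalSpace Unit := ⊥
      have key : P.map (fun ω => ((I.restrict (fun t => V t ω), ()) : (I → S) × Unit))
          = Q.map (fun ω => ((I.restrict (fun t => V t ω), ()) : (I → S) × Unit)) := by
        refine Measure.ext_of_integral_prod_mul_boundedContinuousFunction fun f g => ?_
        have hmeas : Measurable fun p : (I → S) × Unit => (∏ i, f i (p.1 i)) * g p.2 := by
          refine Measurable.mul (Finset.measurable_prod _ fun i _ => ?_) ?_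
          · exact (f i).continuous.measurable.comp ((measurable_pi_apply i).comp measurable_fst)
          · exact (measurable_of_countable g).comp measurable_snd
        rw [integral_map hu.aemeasurable hmeas.aestronglyMeasurable,
          integral_map hu.aemeasurable hmeas.aestronglyMeasurable]
        simp only [Finset.restrict_def]
        rw [integral_mul_const, integral_mul_const]
        congr 1
        have := h I (fun t => if ht : t ∈ I then f ⟨t, ht⟩ else 0)
        have hp : ∀ ω, ∏ i ∈ I, (if ht : i ∈ I then f ⟨i, ht⟩ else 0 : S →ᵇ ℝ) (V i ω)
            = ∏ i : I, f i (V i ω) := by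
          intro ω
          rw [← Finset.prod_coe_sort I]
          refine Finset.prod_congr rfl fun i _ => ?_
          simp
        simpa only [hp] using this
      have := congrArg (fun ν => Measure.map Prod.fst ν) key
      rw [Measure.map_map measurable_fst hu, Measure.map_map measurable_fst hu] at this
      exact this
    exact IsProjectiveLimit.unique (P := fun I : Finset T =>
      (P.map (fun ω t => V t ω)).map I.restrict) (fun I => rfl) (fun I => (hI I).symm)
  ext A hA
  rw [hcomap] at hA
  obtain ⟨A', hA', rfl⟩ := hA
  rw [← Measure.map_apply hVm' hA', ← Measure.map_apply hVm' hA', hmap]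

lemma CadlagPath.measurable_coord {S : Type*} [TopologicalSpace S] [MeasurableSpace S] (t : ℝ≥0) :
    Measurable (CadlagPath.coord (S := S) t) := by
  rw [measurable_iff_comap_le]
  exact le_iSup (fun t : ℝ≥0 => MeasurableSpace.comap (CadlagPath.coord (S := S) t) inferInstance) t

section Obs

variable {E : Type*} [TopologicalSpace E] {q : ℕ}

lemma obsFiltration_mono : Monotone (obsFiltration E q) := fun _ _ h =>
  iSup₂_mono' fun r hr => ⟨r, hr.trans h, le_rfl⟩

lemma obsFiltration_le_comap (t : ℝ≥0) :
    obsFiltration E q t ≤ MeasurableSpace.comap Prod.snd inferInstance := by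
  refine iSup₂_le fun s _ => ?_
  change MeasurableSpace.comap (CadlagPath.coord s ∘ Prod.snd) _ ≤ _
  rw [← MeasurableSpace.comap_comp]
  exact MeasurableSpace.comap_mono (CadlagPath.measurable_coord s).comap_le

/-- Integer times suffice to exhaust the observations, so Lévy's upward theorem applies to a
filtration indexed by `ℕ`. -/
lemma iSup_obsFiltration_nat :
    ⨆ n : ℕ, obsFiltration E q n = MeasurableSpace.comap Prod.snd inferInstance := by
  refine le_antisymm (iSup_le fun n => obsFiltration_le_comap _) ?_
  simp only [CadlagPath.instMeasurableSpace, MeasurableSpace.comap_iSup,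
    MeasurableSpace.comap_comp]
  refine iSup_le fun t => ?_
  obtain ⟨n, hn⟩ := exists_nat_ge t
  exact le_iSup_of_le n (le_iSup₂_of_le t hn le_rfl)

end Obs

variable {E : Type*} [TopologicalSpace E] [MeasurableSpace E] {q : ℕ}

lemma measurable_sig (t : ℝ≥0) : Measurable (sig (E := E) (q := q) t) :=
  (CadlagPath.measurable_coord t).comp measurable_fst

lemma measurable_obs (t : ℝ≥0) : Measurable (obs (E := E) (q := q) t) :=
  (CadlagPath.measurable_coord t).comp measurable_snd

lemma measurableSpace_pathSpace_eq :
    (inferInstance : MeasurableSpace (PathSpace E q)) = ⨆ t : ℝ≥0,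
      MeasurableSpace.comap (fun ω : PathSpace E q => (sig t ω, obs t ω)) inferInstance := by
  refine le_antisymm (sup_le ?_ ?_) (iSup_le fun t => ?_)
  · simp only [CadlagPath.instMeasurableSpace, MeasurableSpace.comap_iSup,
      MeasurableSpace.comap_comp]
    refine iSup_mono fun t => ?_
    change MeasurableSpace.comap (Prod.fst ∘ fun ω : PathSpace E q => (sig t ω, obs t ω)) _ ≤ _
    rw [← MeasurableSpace.comap_comp]
    exact MeasurableSpace.comap_mono le_sup_left
  · simp only [CadlagPath.instMeasurableSpace, MeasurableSpace.comap_iSup,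
      MeasurableSpace.comap_comp]
    refine iSup_mono fun t => ?_
    change MeasurableSpace.comap (Prod.snd ∘ fun ω : PathSpace E q => (sig t ω, obs t ω)) _ ≤ _
    rw [← MeasurableSpace.comap_comp]
    exact MeasurableSpace.comap_mono le_sup_right
  · exact ((measurable_sig t).prodMk (measurable_obs t)).comap_le

lemma pairFiltration_mono : Monotone (pairFiltration E q) := fun _ _ h =>
  sup_le_sup (iSup₂_mono' fun r hr => ⟨r, hr.trans h, le_rfl⟩)
    (iSup₂_mono' fun r hr => ⟨r, hr.trans h, le_rfl⟩)

lemma measurable_sig_pairFiltration {s t : ℝ≥0} (h : s ≤ t) :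
    Measurable[pairFiltration E q t] (sig (E := E) (q := q) s) := by
  rw [measurable_iff_comap_le]
  exact le_sup_of_le_left (le_iSup₂_of_le s h le_rfl)

lemma measurable_obs_pairFiltration {s t : ℝ≥0} (h : s ≤ t) :
    Measurable[pairFiltration E q t] (obs (E := E) (q := q) s) := by
  rw [measurable_iff_comap_le]
  exact le_sup_of_le_right (le_iSup₂_of_le s h le_rfl)

lemma pairFiltration_le (t : ℝ≥0) :
    pairFiltration E q t ≤ (inferInstance : MeasurableSpace (PathSpace E q)) :=
  sup_le (iSup₂_le fun s _ => (measurable_sig s).comap_le)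
    (iSup₂_le fun s _ => (measurable_obs s).comap_le)

end Laws

/-! ### Bounded continuous functions and integrability -/

section BoundedContinuous

variable {S : Type*} [TopologicalSpace S]

lemma isBoundedMeasurable_bcf [MeasurableSpace S] [OpensMeasurableSpace S] (f : S →ᵇ ℝ) :
    IsBoundedMeasurable f :=
  ⟨f.continuous.measurable, ‖f‖, fun x => f.norm_coe_le_norm x⟩

lemma abs_prod_bcf_le {T : Type*} (I : Finset T) (f : T → (S →ᵇ ℝ)) (z : T → S) :
    |∏ i ∈ I, f i (z i)| ≤ ∏ i ∈ I, ‖f i‖ := by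
  rw [Finset.abs_prod]
  exact Finset.prod_le_prod (fun _ _ => abs_nonneg _) fun i _ => (f i).norm_coe_le_norm _

end BoundedContinuous

lemma integrable_of_abs_le {Ω : Type*} {m₀ : MeasurableSpace Ω} {κ : Measure Ω}
    [IsFiniteMeasure κ] {f : Ω → ℝ} (hf : AEStronglyMeasurable f κ) {C : ℝ}
    (hC : ∀ ω, |f ω| ≤ C) : Integrable f κ :=
  Integrable.of_bound hf C (Eventually.of_forall hC)

/-! ### Markov additivity and the Markov property -/

namespace HiddenMarkovModel

lemma abs_kernelOp_le {E : Type*} [TopologicalSpace E] [MeasurableSpace E] {q : ℕ}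
    {M : HiddenMarkovModel E q} (r : ℝ≥0) {f : E × ObsSpace q → ℝ} {C : ℝ} (hC : ∀ p, |f p| ≤ C)
    (p : E × ObsSpace q) : |kernelOp (M.trans r) f p| ≤ C := by
  have := M.markovKernel r
  have := norm_integral_le_of_norm_le_const (μ := M.trans r p) (f := f) (C := C)
    (Eventually.of_forall hC)
  simpa [kernelOp] using this

/-- Markov additivity, in the form that the transition operators commute with translations. -/
lemma kernelOp_obsTranslate {E : Type*} [TopologicalSpace E] [MeasurableSpace E] {q : ℕ}
    (M : HiddenMarkovModel E q) (r : ℝ≥0) {f : E × ObsSpace q → ℝ} (hf : IsBoundedMeasurable f)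
    (w : ObsSpace q) (p : E × ObsSpace q) :
    kernelOp (M.trans r) (obsTranslate w f) p = kernelOp (M.trans r) f (p.1, p.2 - w) := by
  have hg : IsBoundedMeasurable (obsTranslate (w - p.2) f) :=
    ⟨hf.1.comp (measurable_fst.prodMk (measurable_snd.sub_const _)),
      hf.2.imp fun C hC x => hC _⟩
  have := M.additive r _ hg p.1 p.2 (p.2 - w)
  have e : ∀ u, obsTranslate u (obsTranslate (w - p.2) f) = obsTranslate (u + (w - p.2)) f :=
    fun u => funext fun z => by simp [obsTranslate, sub_sub]
  have e0 : obsTranslate 0 f = f := funext fun z => by simp [obsTranslate]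
  rw [e, e] at this
  simpa [e0] using this

/-- The Markov property with a parameter known at the present time. -/
lemma setIntegral_markov_param {E : Type*} [TopologicalSpace E] [MeasurableSpace E] {q : ℕ}
    (M : HiddenMarkovModel E q) (μ : ProbabilityMeasure E) {s₀ s : ℝ≥0} (hs : s₀ ≤ s) (r : ℝ≥0)
    {f : E × ObsSpace q → ℝ} (hf : IsBoundedMeasurable f) {B : Set (PathSpace E q)}
    (hB : MeasurableSet[usualAugmentation M.law (pairFiltration E q) s] B) :
    ∫ ω in B, f (sig (s + r) ω, obs (s + r) ω - obs s₀ ω) ∂(M.law μ)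
      = ∫ ω in B, kernelOp (M.trans r) f (sig s ω, obs s ω - obs s₀ ω) ∂(M.law μ) := by
  have := M.markovKernel r
  have := M.isProbabilityMeasure_law μ
  let Z : ℝ≥0 → PathSpace E q → E × ObsSpace q := fun t ω => (sig t ω, obs t ω)
  have hZ : ∀ t, Measurable (Z t) := fun t => (measurable_sig t).prodMk (measurable_obs t)
  have hW : Measurable (obs (E := E) (q := q) s₀) := measurable_obs s₀
  let κ : Kernel (ObsSpace q × (E × ObsSpace q)) (ObsSpace q × (E × ObsSpace q)) :=
    Kernel.id ∥ₖ M.trans r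
  have hκ : ∀ p, κ p = (Measure.dirac p.1).prod (M.trans r p.2) := fun p => by
    rw [Kernel.parallelComp_apply, Kernel.id_apply]
  -- The joint law carries the frozen value `Y_{s₀}` along unchanged. On rectangles, the event about
  -- `Y_{s₀}` belongs to the past because `s₀ ≤ s`, and is absorbed into `B`.
  have key : ((M.law μ).restrict B).map (fun ω => (obs s₀ ω, Z (s + r) ω))
      = κ ∘ₘ ((M.law μ).restrict B).map (fun ω => (obs s₀ ω, Z s ω)) := by
    refine Measure.ext_prod fun {C A} hC hA => ?_
    have hD : MeasurableSet[pairFiltration E q s] (obs (E := E) (q := q) s₀ ⁻¹' C) :=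
      measurable_obs_pairFiltration hs hC
    have hD' := le_usualAugmentation (P := M.law) pairFiltration_mono s _ hD
    have hind : IsBoundedMeasurable (A.indicator (fun _ => (1 : ℝ))) :=
      ⟨measurable_const.indicator hA, 1, fun x => by
        by_cases hx : x ∈ A <;> simp [hx]⟩
    have hmar := M.markov μ s r _ hind _ (hD'.inter hB)
    rw [← Measure.restrict_restrict (hW hC)] at hmar
    rw [Measure.map_apply (hW.prodMk (hZ _)) (hC.prod hA), Measure.bind_apply (hC.prod hA)
      (Kernel.aemeasurable _), lintegral_map (Kernel.measurable_coe _ (hC.prod hA))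
      (hW.prodMk (hZ _))]
    have hA' : ∀ p, kernelOp (M.trans r) (A.indicator fun _ => (1 : ℝ)) p
        = (M.trans r p A).toReal := fun p => by
      rw [kernelOp, integral_indicator_const _ hA]; simp [Measure.real]
    have hl : ∀ ω, κ (obs s₀ ω, Z s ω) (C ×ˢ A)
        = (obs (E := E) (q := q) s₀ ⁻¹' C).indicator (fun ω => M.trans r (Z s ω) A) ω := by
      intro ω
      rw [hκ, Measure.prod_prod, Measure.dirac_apply' _ hC]
      by_cases h : obs s₀ ω ∈ C <;> simp [h, Set.indicator]
    simp_rw [hl]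
    rw [lintegral_indicator (hW hC)]
    have e1 : (obs (E := E) (q := q) s₀ ⁻¹' C) ∩ Z (s + r) ⁻¹' A
        = (fun ω => (obs s₀ ω, Z (s + r) ω)) ⁻¹' C ×ˢ A := by
      ext ω; simp
    rw [← e1, inter_comm, ← Measure.restrict_apply ((hZ _) hA)]
    set κ' := ((M.law μ).restrict B).restrict (obs (E := E) (q := q) s₀ ⁻¹' C)
    have hL : ∫ ω, A.indicator (fun _ => (1 : ℝ)) (sig (s + r) ω, obs (s + r) ω) ∂κ'
        = (κ' (Z (s + r) ⁻¹' A)).toReal := by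
      have : ∀ ω, A.indicator (fun _ => (1 : ℝ)) (sig (s + r) ω, obs (s + r) ω)
          = (Z (s + r) ⁻¹' A).indicator (fun _ => (1 : ℝ)) ω := fun ω => by
        simp only [Set.indicator, mem_preimage]; rfl
      simp_rw [this]
      rw [integral_indicator_const _ (hZ _ hA)]; simp [Measure.real]
    have hmeas : Measurable fun ω => M.trans r (Z s ω) A :=
      (Kernel.measurable_coe _ hA).comp (hZ s)
    have hR : ∫ ω, kernelOp (M.trans r) (A.indicator fun _ => (1 : ℝ)) (sig s ω, obs s ω) ∂κ'
        = (∫⁻ ω, M.trans r (Z s ω) A ∂κ').toReal := by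
      simp_rw [hA']
      exact integral_toReal hmeas.aemeasurable
        (Eventually.of_forall fun ω => measure_lt_top _ _)
    rw [hL, hR] at hmar
    refine (ENNReal.toReal_eq_toReal_iff' (measure_ne_top _ _) ?_).1 hmar
    refine ((lintegral_mono fun ω => prob_le_one).trans_lt ?_).ne
    simp
  let Φ : ObsSpace q × (E × ObsSpace q) → ℝ := fun p => obsTranslate p.1 f p.2
  have hΦ : Measurable Φ := by
    refine hf.1.comp ?_
    fun_prop
  obtain ⟨C, hC⟩ := hf.2
  have hL : ∫ p, Φ p ∂(((M.law μ).restrict B).map (fun ω => (obs s₀ ω, Z (s + r) ω)))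
      = ∫ ω in B, f (sig (s + r) ω, obs (s + r) ω - obs s₀ ω) ∂(M.law μ) := by
    rw [integral_map (hW.prodMk (hZ _)).aemeasurable hΦ.aestronglyMeasurable]
    rfl
  rw [← hL, key, Measure.comp_eq_comp_const_apply,
    Kernel.integral_comp (integrable_of_abs_le hΦ.aestronglyMeasurable
    fun p => hC _), Kernel.const_apply, integral_map (hW.prodMk (hZ _)).aemeasurable]
  · refine integral_congr_ae (Eventually.of_forall fun ω => ?_)
    dsimp only
    rw [hκ, integral_prod _ (integrable_of_abs_le hΦ.aestronglyMeasurable fun p => hC _),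
      integral_dirac' _ _ (hΦ.stronglyMeasurable.integral_prod_right)]
    exact M.kernelOp_obsTranslate r hf _ _
  · exact (hΦ.stronglyMeasurable.integral_kernel).aestronglyMeasurable

variable {E : Type*} [MetricSpace E] [CompactSpace E] [MeasurableSpace E] [BorelSpace E] {q : ℕ}

/-! ### From `C₀` to bounded continuous functions -/

section Feller

variable {M : HiddenMarkovModel E q}

/-- The Feller property extends from `C₀` to the bounded continuous functions. -/
lemma IsFeller.continuous_kernelOp (hM : M.IsFeller) (r : ℝ≥0) (f : E × ObsSpace q →ᵇ ℝ) :
    Continuous (kernelOp (M.trans r) f) := by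
  have := M.markovKernel r
  -- Cutoffs in the observation variable have compact support because `E` is compact. Where `T_r
  -- χ_n` exceeds `1 - δ`, replacing `f` by `f χ_n` costs at most `‖f‖ δ`. This set is open because
  -- `T_r χ_n` is continuous, so the approximation is locally uniform.
  let χ : ℕ → E × ObsSpace q → ℝ := fun n p => max 0 (min 1 (n + 1 - ‖p.2‖))
  have hχc : ∀ n, Continuous (χ n) := fun n => by fun_prop
  have hχ0 : ∀ n p, 0 ≤ χ n p := fun n p => le_max_left _ _
  have hχ1 : ∀ n p, χ n p ≤ 1 := fun n p => max_le zero_le_one (min_le_left _ _)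
  have hχs : ∀ n, HasCompactSupport (χ n) := fun n => by
    refine HasCompactSupport.of_support_subset_isCompact
      (isCompact_univ.prod (isCompact_closedBall (0 : ObsSpace q) (n + 1))) fun p hp => ?_
    refine ⟨mem_univ _, ?_⟩
    rw [mem_closedBall_zero_iff]
    by_contra! h
    refine hp ?_
    have : min 1 ((n : ℝ) + 1 - ‖p.2‖) ≤ 0 := (min_le_right _ _).trans (by linarith)
    exact max_eq_left this
  have hχt : ∀ p, Tendsto (fun n => χ n p) atTop (𝓝 1) := fun p => by
    refine tendsto_const_nhds.congr' ?_
    obtain ⟨N, hN⟩ := exists_nat_ge ‖p.2‖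
    filter_upwards [eventually_ge_atTop N] with n hn
    have : (N : ℝ) ≤ n := by exact_mod_cast hn
    have h1 : min 1 ((n : ℝ) + 1 - ‖p.2‖) = 1 := min_eq_left (by linarith)
    simp [χ, h1]
  have hcont : ∀ g : E × ObsSpace q → ℝ, Continuous g → HasCompactSupport g →
      Continuous (kernelOp (M.trans r) g) := fun g hg hgs => by
    obtain ⟨k, hk⟩ := hM.mapsTo r ⟨⟨g, hg⟩, hgs.is_zero_at_infty⟩
    have : kernelOp (M.trans r) g = k := funext fun p => (hk p).symm
    rw [this]
    exact k.continuous
  have hχi : ∀ n p, Integrable (χ n) (M.trans r p) := fun n p =>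
    integrable_of_abs_le (hχc n).aestronglyMeasurable fun z => by
      rw [abs_of_nonneg (hχ0 n z)]; exact hχ1 n z
  have hlim : ∀ p, Tendsto (fun n => kernelOp (M.trans r) (χ n) p) atTop (𝓝 1) := fun p => by
    have := tendsto_integral_of_dominated_convergence (μ := M.trans r p) (F := χ)
      (f := fun _ => (1 : ℝ)) (fun _ => 1) (fun n => (hχc n).aestronglyMeasurable)
      (integrable_const _) (fun n => Eventually.of_forall fun z => by
        rw [Real.norm_eq_abs, abs_of_nonneg (hχ0 n z)]; exact hχ1 n z)
      (Eventually.of_forall hχt)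
    simpa [kernelOp] using this
  refine continuous_of_locally_uniform_approx_of_continuousAt fun p u hu => ?_
  obtain ⟨ε, hε, hu⟩ := Metric.mem_uniformity_dist.1 hu
  have hδ : 0 < ε / (‖f‖ + 1) := by positivity
  obtain ⟨n, hn⟩ := ((hlim p).eventually (lt_mem_nhds (sub_lt_self 1 hδ))).exists
  refine ⟨_, (hcont _ (hχc n) (hχs n)).continuousAt.eventually (lt_mem_nhds hn),
    kernelOp (M.trans r) (fun z => f z * χ n z),
    (hcont _ (f.continuous.mul (hχc n)) (hχs n).mul_left).continuousAt, fun z hz => hu ?_⟩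
  have hfi : Integrable f (M.trans r z) :=
    integrable_of_abs_le f.continuous.aestronglyMeasurable f.norm_coe_le_norm
  have hfχi : Integrable (fun y => f y * χ n y) (M.trans r z) :=
    hfi.mul_of_top_left (memLp_top_of_bound (hχc n).aestronglyMeasurable 1
      (Eventually.of_forall fun y => by
        rw [Real.norm_eq_abs, abs_of_nonneg (hχ0 n y)]; exact hχ1 n y))
  rw [Real.dist_eq, kernelOp, kernelOp, ← integral_sub hfi hfχi]
  have hb : ∀ y, |f y - f y * χ n y| ≤ ‖f‖ * (1 - χ n y) := fun y => by
    rw [show f y - f y * χ n y = f y * (1 - χ n y) by ring, abs_mul,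
      abs_of_nonneg (sub_nonneg.2 (hχ1 n y))]
    exact mul_le_mul_of_nonneg_right (f.norm_coe_le_norm y) (sub_nonneg.2 (hχ1 n y))
  have hz' : 1 - kernelOp (M.trans r) (χ n) z < ε / (‖f‖ + 1) := by
    have : 1 - ε / (‖f‖ + 1) < kernelOp (M.trans r) (χ n) z := hz
    linarith
  calc |∫ y, (f y - f y * χ n y) ∂(M.trans r z)|
      ≤ ∫ y, ‖f‖ * (1 - χ n y) ∂(M.trans r z) :=
        (abs_integral_le_integral_abs).trans
          (integral_mono (hfi.sub hfχi).abs (((integrable_const _).sub (hχi n z)).const_mul _) hb)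
    _ = ‖f‖ * (1 - kernelOp (M.trans r) (χ n) z) := by
        rw [integral_const_mul, integral_sub (integrable_const _) (hχi n z)]
        simp [kernelOp]
    _ ≤ ‖f‖ * (ε / (‖f‖ + 1)) := mul_le_mul_of_nonneg_left hz'.le (norm_nonneg _)
    _ < (‖f‖ + 1) * (ε / (‖f‖ + 1)) := mul_lt_mul_of_pos_right (lt_add_one _) hδ
    _ = ε := by field_simp

/-- The transition operator of a Feller model on bounded continuous functions. -/
def IsFeller.op (hM : M.IsFeller) (r : ℝ≥0) (f : E × ObsSpace q →ᵇ ℝ) : E × ObsSpace q →ᵇ ℝ :=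
  BoundedContinuousFunction.ofNormedAddCommGroup (kernelOp (M.trans r) f)
    (hM.continuous_kernelOp r f) ‖f‖ (abs_kernelOp_le r f.norm_coe_le_norm)

end Feller

/-! ### Prediction of products of future increments -/

section Markov

/-- The Markov property for finite products of functions of the future of the pair, where the
observations start afresh at the present time. The function `U` is the same for all initial
laws and all times. -/
lemma IsFeller.exists_setIntegral_prod_eq {M : HiddenMarkovModel E q} (hM : M.IsFeller)
    (f : ℝ≥0 → (E × ObsSpace q →ᵇ ℝ)) (I : Finset ℝ≥0) :
    ∀ a, (∀ i ∈ I, a ≤ i) → ∃ U : E × ObsSpace q →ᵇ ℝ, ∀ (μ : ProbabilityMeasure E) (t : ℝ≥0)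
      (B : Set (PathSpace E q)),
      MeasurableSet[usualAugmentation M.law (pairFiltration E q) (t + a)] B →
      ∫ ω in B, ∏ i ∈ I, f i (sig (t + i) ω, obs (t + i) ω - obs t ω) ∂(M.law μ)
        = ∫ ω in B, U (sig (t + a) ω, obs (t + a) ω - obs t ω) ∂(M.law μ) := by
  classical
  induction I using Finset.induction_on_min with
  | empty => exact fun a _ => ⟨1, fun μ t B _ => by simp⟩
  | insert b I hb ih =>
    intro a ha
    obtain ⟨U, hU⟩ := ih b fun i hi => (hb i hi).le
    have hab : a ≤ b := ha b (Finset.mem_insert_self _ _)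
    -- Backward recursion: `U` predicts the later factors at time `b`; multiply by the factor at `b`
    -- and transport back to `a`. The free starting time `a` is what lets the induction close.
    refine ⟨hM.op (b - a) (f b * U), fun μ t B hB => ?_⟩
    have := M.isProbabilityMeasure_law μ
    have hZ : ∀ i, Measurable fun ω : PathSpace E q =>
        (sig (t + i) ω, obs (t + i) ω - obs t ω) := fun i =>
      (measurable_sig _).prodMk ((measurable_obs _).sub (measurable_obs _))
    have hta : t + b = t + a + (b - a) := by rw [add_assoc, add_tsub_cancel_of_le hab]
    have hbI : b ∉ I := fun h => lt_irrefl _ (hb b h)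
    have hP : Measurable fun ω : PathSpace E q =>
        ∏ i ∈ I, f i (sig (t + i) ω, obs (t + i) ω - obs t ω) :=
      Finset.measurable_prod _ fun i _ => (f i).continuous.measurable.comp (hZ i)
    have hPi : Integrable (fun ω : PathSpace E q =>
        ∏ i ∈ I, f i (sig (t + i) ω, obs (t + i) ω - obs t ω)) ((M.law μ).restrict B) :=
      integrable_of_abs_le hP.aestronglyMeasurable fun ω => abs_prod_bcf_le I f _
    have hUi : Integrable (fun ω : PathSpace E q =>
        U (sig (t + b) ω, obs (t + b) ω - obs t ω)) ((M.law μ).restrict B) :=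
      integrable_of_abs_le (U.continuous.measurable.comp (hZ b)).aestronglyMeasurable
        fun ω => U.norm_coe_le_norm _
    have hbm : MemLp (fun ω : PathSpace E q =>
        f b (sig (t + b) ω, obs (t + b) ω - obs t ω)) ⊤ ((M.law μ).restrict B) :=
      memLp_top_of_bound ((f b).continuous.measurable.comp (hZ b)).aestronglyMeasurable ‖f b‖
        (Eventually.of_forall fun ω => (f b).norm_coe_le_norm _)
    have hsm : StronglyMeasurable[pairFiltration E q (t + b)] fun ω : PathSpace E q =>
        f b (sig (t + b) ω, obs (t + b) ω - obs t ω) := by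
      refine Measurable.stronglyMeasurable ?_
      refine (f b).continuous.measurable.comp ?_
      exact Measurable.prodMk (measurable_sig_pairFiltration le_rfl)
        ((measurable_obs_pairFiltration le_rfl).sub (measurable_obs_pairFiltration le_self_add))
    have hB' : MeasurableSet[usualAugmentation M.law (pairFiltration E q) (t + b)] B :=
      usualAugmentation_mono_time (add_le_add_right hab t) _ hB
    -- `B` lives in the augmentation, so it is built into the measure, and the orthogonality is used
    -- for the raw filtration at `t + b`.
    have h0 := integral_mul_eq_zero_of_forall_setIntegral_eq_zero (pairFiltration_le (t + b)) hsm
      (hPi.sub hUi) ((hPi.sub hUi).mul_of_top_right hbm) fun C hC => by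
        have hC' := le_usualAugmentation (P := M.law) pairFiltration_mono _ _ hC
        simp only [Pi.sub_apply]
        rw [integral_sub hPi.integrableOn hUi.integrableOn,
          Measure.restrict_restrict (pairFiltration_le _ _ hC), hU μ t _ (hC'.inter hB'), sub_self]
    have e1 : ∀ ω : PathSpace E q,
        f b (sig (t + b) ω, obs (t + b) ω - obs t ω) *
          ((∏ i ∈ I, f i (sig (t + i) ω, obs (t + i) ω - obs t ω))
            - U (sig (t + b) ω, obs (t + b) ω - obs t ω))
        = (∏ i ∈ insert b I, f i (sig (t + i) ω, obs (t + i) ω - obs t ω))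
          - (f b * U) (sig (t + b) ω, obs (t + b) ω - obs t ω) := fun ω => by
      rw [Finset.prod_insert hbI, BoundedContinuousFunction.mul_apply]; ring
    simp only [Pi.sub_apply, e1] at h0
    rw [integral_sub] at h0
    · rw [sub_eq_zero.1 h0, hta]
      exact M.setIntegral_markov_param μ le_self_add (b - a) (isBoundedMeasurable_bcf _) hB
    · refine integrable_of_abs_le (Measurable.aestronglyMeasurable ?_)
        fun ω => abs_prod_bcf_le (insert b I) f _
      exact Finset.measurable_prod _ fun i _ => (f i).continuous.measurable.comp (hZ i)
    · exact integrable_of_abs_le ((f b * U).continuous.measurable.comp (hZ b)).aestronglyMeasurable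
        fun ω => (f b * U).norm_coe_le_norm _

end Markov

end HiddenMarkovModel

namespace HiddenMarkovModel

/-! ### Initial observation, integrals against filters, dominating laws -/

section General

variable {E : Type*} [TopologicalSpace E] [MeasurableSpace E] {q : ℕ} (M : HiddenMarkovModel E q)

lemma ae_obs_zero (μ : ProbabilityMeasure E) : ∀ᵐ ω ∂(M.law μ), obs 0 ω = 0 := by
  have := M.isProbabilityMeasure_law μ
  let A : Set (E × ObsSpace q) := Prod.snd ⁻¹' {0}ᶜ
  have hA : MeasurableSet A := measurable_snd (measurableSet_singleton _).compl
  have hind : IsBoundedMeasurable (A.indicator (fun _ => (1 : ℝ))) :=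
    ⟨measurable_const.indicator hA, 1, fun x => by
      by_cases hx : x ∈ A <;> simp [hx]⟩
  have h := M.marginal μ 0 _ hind
  have hR : ∀ x : E, kernelOp (M.trans 0) (A.indicator (fun _ => (1 : ℝ))) (x, 0) = 0 := by
    intro x
    rw [kernelOp, M.trans_zero, Kernel.id_apply,
      integral_dirac' _ _ hind.1.stronglyMeasurable]
    simp [A]
  have hZ : Measurable fun ω : PathSpace E q => (sig 0 ω, obs 0 ω) :=
    (measurable_sig _).prodMk (measurable_obs _)
  have hL : ∀ ω : PathSpace E q, A.indicator (fun _ => (1 : ℝ)) (sig 0 ω, obs 0 ω)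
      = ((fun ω => (sig 0 ω, obs 0 ω)) ⁻¹' A).indicator (fun _ => (1 : ℝ)) ω := fun ω => by
    simp only [Set.indicator]; rfl
  simp_rw [hL] at h
  rw [integral_indicator_const _ (hZ hA)] at h
  simp only [hR, integral_zero, smul_eq_mul, mul_one] at h
  rw [measureReal_eq_zero_iff] at h
  exact measure_mono_null (fun ω hω => hω) h

lemma augObsFiltration_le_pair (t : ℝ≥0) :
    M.augObsFiltration t ≤ usualAugmentation M.law (pairFiltration E q) t :=
  usualAugmentation_mono (fun _ => le_sup_right) t

/-- The null sets are those of one law only. Two laws are handled at once by taking for `μ` a law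
that dominates both. -/
lemma augObsFiltration_le_eventuallyMeasurable (μ : ProbabilityMeasure E) (t : ℝ≥0) :
    M.augObsFiltration t ≤ eventuallyMeasurableSpace
      (MeasurableSpace.comap Prod.snd inferInstance) (ae (M.law μ)) :=
  usualAugmentation_le (fun t => obsFiltration_le_comap t) t μ

lemma comap_snd_le : MeasurableSpace.comap (Prod.snd : PathSpace E q → CadlagPath (ObsSpace q))
    inferInstance ≤ (inferInstance : MeasurableSpace (PathSpace E q)) :=
  measurable_snd.comap_le

lemma nullMeasurableSet_of_augObsFiltration {t : ℝ≥0} {B : Set (PathSpace E q)}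
    (hB : MeasurableSet[M.augObsFiltration t] B) (μ : ProbabilityMeasure E) :
    NullMeasurableSet B (M.law μ) :=
  nullMeasurableSet_of_eventuallyMeasurableSet comap_snd_le
    (M.augObsFiltration_le_eventuallyMeasurable μ t _ hB)

lemma nullMeasurable_of_augObsFiltration {β : Type*} [MeasurableSpace β] {t : ℝ≥0}
    {f : PathSpace E q → β} (hf : Measurable[M.augObsFiltration t] f) (μ : ProbabilityMeasure E) :
    NullMeasurable f (M.law μ) := fun _ hs =>
  M.nullMeasurableSet_of_augObsFiltration (hf hs) μ

variable {M} in
/-- The integral formula for the filter, for nonnegative functions. -/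
lemma IsFilter.setLIntegral_eq [OpensMeasurableSpace E] {μ : ProbabilityMeasure E}
    {π : ℝ≥0 → PathSpace E q → ProbabilityMeasure E} (hπ : M.IsFilter μ π) (t : ℝ≥0)
    {u : E → ℝ≥0∞} (hu : Measurable u) {B : Set (PathSpace E q)}
    (hB : MeasurableSet[M.augObsFiltration t] B) :
    ∫⁻ ω in B, ∫⁻ x, u x ∂(π t ω : Measure E) ∂(M.law μ) = ∫⁻ ω in B, u (sig t ω) ∂(M.law μ) := by
  have hm : ∀ v : E → ℝ≥0∞, Measurable v →
      AEMeasurable (fun ω => ∫⁻ x, v x ∂(π t ω : Measure E)) ((M.law μ).restrict B) := by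
    intro v hv
    have : Measurable[M.augObsFiltration t] fun ω => (π t ω : Measure E) :=
      Measure.measurable_of_measurable_coe _ fun A hA => hπ.adapted t A hA
    have := (Measure.measurable_lintegral hv).comp this
    exact ((M.nullMeasurable_of_augObsFiltration this μ).aemeasurable).restrict
  refine Measurable.ennreal_induction
    (motive := fun u => ∫⁻ ω in B, ∫⁻ x, u x ∂(π t ω : Measure E) ∂(M.law μ)
      = ∫⁻ ω in B, u (sig t ω) ∂(M.law μ)) (fun c A hA => ?_) (fun f g _ hf hg ihf ihg => ?_)
    (fun f hf hmono ih => ?_) hu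
  · have hA' := (measurable_sig (E := E) (q := q) t) hA
    have e : ∀ ω : PathSpace E q, A.indicator (fun _ => c) (sig t ω)
        = (sig t ⁻¹' A).indicator (fun _ => c) ω := fun ω => by
      simp only [Set.indicator]; rfl
    simp_rw [e]
    rw [lintegral_indicator_const hA', Measure.restrict_apply hA', inter_comm,
      ← hπ.condLaw t A hA B hB]
    simp_rw [lintegral_indicator_const hA]
    have := hm (A.indicator 1) (measurable_one.indicator hA)
    simp_rw [lintegral_indicator_one hA] at this
    exact lintegral_const_mul'' _ this
  · simp only [Pi.add_apply]
    simp_rw [lintegral_add_left hf]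
    have hfs : Measurable fun ω : PathSpace E q => f (sig t ω) := hf.comp (measurable_sig t)
    rw [lintegral_add_left' (hm f hf), lintegral_add_left hfs, ihf, ihg]
  · have hmono' : ∀ ω, Monotone fun n => ∫⁻ x, f n x ∂(π t ω : Measure E) := fun ω n k hnk =>
      lintegral_mono (hmono hnk)
    simp_rw [lintegral_iSup hf hmono]
    have hfs : ∀ n, Measurable fun ω : PathSpace E q => f n (sig t ω) := fun n =>
      (hf n).comp (measurable_sig t)
    rw [lintegral_iSup' (fun n => hm _ (hf n)) (Eventually.of_forall hmono'),
      lintegral_iSup hfs (fun n k hnk ω => hmono hnk _)]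
    exact iSup_congr ih

variable {M} [OpensMeasurableSpace E]

/-- The shift by `‖u‖` makes the integrand nonnegative, so statements about `∫⁻` transfer to signed
`u`. -/
lemma integral_eq_toReal_lintegral_sub {S : Type*} [TopologicalSpace S] [MeasurableSpace S]
    [OpensMeasurableSpace S] (u : S →ᵇ ℝ) (ν : Measure S) [IsProbabilityMeasure ν] :
    ∫ x, u x ∂ν = (∫⁻ x, ENNReal.ofReal (u x + ‖u‖) ∂ν).toReal - ‖u‖ := by
  have h1 : Integrable (fun x => u x) ν :=
    integrable_of_abs_le u.continuous.aestronglyMeasurable u.norm_coe_le_norm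
  have hpos : ∀ x, 0 ≤ u x + ‖u‖ := fun x => by
    have := neg_le_of_abs_le (u.norm_coe_le_norm x); linarith
  have h2 := integral_eq_lintegral_of_nonneg_ae (μ := ν) (f := fun x => u x + ‖u‖)
    (Eventually.of_forall hpos) (h1.add (integrable_const _)).aestronglyMeasurable
  rw [← h2, integral_add h1 (integrable_const _)]
  simp

lemma IsFilter.measurable_integral {μ : ProbabilityMeasure E}
    {π : ℝ≥0 → PathSpace E q → ProbabilityMeasure E} (hπ : M.IsFilter μ π) (t : ℝ≥0)
    (u : E →ᵇ ℝ) : Measurable[M.augObsFiltration t] fun ω => ∫ x, u x ∂(π t ω : Measure E) := by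
  have h1 : Measurable[M.augObsFiltration t] fun ω => (π t ω : Measure E) :=
    Measure.measurable_of_measurable_coe _ fun A hA => hπ.adapted t A hA
  have hv : Measurable fun x => ENNReal.ofReal (u x + ‖u‖) :=
    (u.continuous.measurable.add_const _).ennreal_ofReal
  simp_rw [integral_eq_toReal_lintegral_sub u]
  exact ((ENNReal.measurable_toReal.sub_const _).comp (Measure.measurable_lintegral hv)).comp h1

lemma abs_integral_bcf_le {S : Type*} [TopologicalSpace S] [MeasurableSpace S]
    [OpensMeasurableSpace S] (u : S →ᵇ ℝ) (ν : Measure S) [IsProbabilityMeasure ν] :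
    |∫ x, u x ∂ν| ≤ ‖u‖ := by
  have := norm_integral_le_of_norm_le_const (μ := ν) (f := u) (C := ‖u‖)
    (Eventually.of_forall u.norm_coe_le_norm)
  simpa using this

lemma IsFilter.integrable_integral {μ : ProbabilityMeasure E}
    {π : ℝ≥0 → PathSpace E q → ProbabilityMeasure E} (hπ : M.IsFilter μ π) (t : ℝ≥0)
    (u : E →ᵇ ℝ) (ν : ProbabilityMeasure E) :
    Integrable (fun ω => ∫ x, u x ∂(π t ω : Measure E)) (M.law ν) := by
  have := M.isProbabilityMeasure_law ν
  exact integrable_of_abs_le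
    (M.nullMeasurable_of_augObsFiltration (hπ.measurable_integral t u)
      ν).aemeasurable.aestronglyMeasurable
    fun ω => abs_integral_bcf_le u _

/-- The integral formula for the filter. -/
lemma IsFilter.setIntegral_eq {μ : ProbabilityMeasure E}
    {π : ℝ≥0 → PathSpace E q → ProbabilityMeasure E} (hπ : M.IsFilter μ π) (t : ℝ≥0)
    (u : E →ᵇ ℝ) {B : Set (PathSpace E q)} (hB : MeasurableSet[M.augObsFiltration t] B) :
    ∫ ω in B, ∫ x, u x ∂(π t ω : Measure E) ∂(M.law μ) = ∫ ω in B, u (sig t ω) ∂(M.law μ) := by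
  have := M.isProbabilityMeasure_law μ
  have hv : Measurable fun x => ENNReal.ofReal (u x + ‖u‖) :=
    (u.continuous.measurable.add_const _).ennreal_ofReal
  have h := hπ.setLIntegral_eq t hv hB
  have hum : Measurable fun ω : PathSpace E q => u (sig t ω) :=
    u.continuous.measurable.comp (measurable_sig t)
  have hui : Integrable (fun ω : PathSpace E q => u (sig t ω)) (M.law μ) :=
    integrable_of_abs_le hum.aestronglyMeasurable fun ω => u.norm_coe_le_norm _
  have hpos : ∀ x, 0 ≤ u x + ‖u‖ := fun x => by
    have := neg_le_of_abs_le (u.norm_coe_le_norm x); linarith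
  have hR : ∫ ω in B, (u (sig t ω) + ‖u‖) ∂(M.law μ)
      = (∫⁻ ω in B, ENNReal.ofReal (u (sig t ω) + ‖u‖) ∂(M.law μ)).toReal :=
    integral_eq_lintegral_of_nonneg_ae (Eventually.of_forall fun ω => hpos _)
      (hum.add_const _).aestronglyMeasurable
  have hpos' : ∀ ω, 0 ≤ (∫ x, u x ∂(π t ω : Measure E)) + ‖u‖ := fun ω => by
    have := neg_le_of_abs_le (abs_integral_bcf_le u (π t ω : Measure E)); linarith
  have hL : ∫ ω in B, ((∫ x, u x ∂(π t ω : Measure E)) + ‖u‖) ∂(M.law μ)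
      = (∫⁻ ω in B, ∫⁻ x, ENNReal.ofReal (u x + ‖u‖) ∂(π t ω : Measure E) ∂(M.law μ)).toReal := by
    rw [integral_eq_lintegral_of_nonneg_ae (Eventually.of_forall hpos')
      ((hπ.integrable_integral t u μ).integrableOn.add
        (integrable_const _)).aestronglyMeasurable]
    congr 1
    refine lintegral_congr fun ω => ?_
    rw [integral_eq_toReal_lintegral_sub u, sub_add_cancel, ENNReal.ofReal_toReal]
    refine ((lintegral_mono fun x => ENNReal.ofReal_le_ofReal
      (add_le_add_left ((le_abs_self _).trans (u.norm_coe_le_norm x)) ‖u‖)).trans_lt ?_).ne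
    simp
  rw [h, ← hR, integral_add (hπ.integrable_integral t u μ).integrableOn (integrable_const _),
    integral_add hui.integrableOn (integrable_const _)] at hL
  exact add_right_cancel hL

end General

variable {E : Type*} [MetricSpace E] [CompactSpace E] [MeasurableSpace E] [BorelSpace E] {q : ℕ}
  {M : HiddenMarkovModel E q}

/-- The laws of a Feller model depend affinely on the initial law. -/
lemma IsFeller.law_midpoint (hM : M.IsFeller) {μ ν η : ProbabilityMeasure E}
    (h : (2 : ℝ≥0∞) • (η : Measure E) = μ + ν) :
    (2 : ℝ≥0∞) • M.law η = M.law μ + M.law ν := by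
  have := M.isProbabilityMeasure_law
  have : IsFiniteMeasure ((2 : ℝ≥0∞) • M.law η) := (M.law η).smul_finite (by simp)
  refine ext_of_forall_integral_prod_process (fun t ω => (sig t ω, obs t ω))
    measurableSpace_pathSpace_eq fun I f => ?_
  -- Since `U` does not depend on the initial law, each test integral equals `∫ U (x, 0) dκ`, which
  -- is affine in `κ`.
  obtain ⟨U, hU⟩ := hM.exists_setIntegral_prod_eq f I 0 fun i _ => zero_le
  have key : ∀ κ : ProbabilityMeasure E,
      ∫ ω, ∏ i ∈ I, f i (sig i ω, obs i ω) ∂(M.law κ) = ∫ x, U (x, 0) ∂(κ : Measure E) := by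
    intro κ
    have h1 := hU κ 0 univ MeasurableSet.univ
    simp only [zero_add, Measure.restrict_univ] at h1
    have h2 := M.marginal κ 0 U (isBoundedMeasurable_bcf U)
    have h3 : ∀ p, kernelOp (M.trans 0) U p = U p := fun p => by
      rw [kernelOp, M.trans_zero, Kernel.id_apply,
        integral_dirac' _ _ U.continuous.measurable.stronglyMeasurable]
    simp_rw [h3] at h2
    rw [← h2]
    refine Eq.trans (integral_congr_ae ?_) (h1.trans (integral_congr_ae ?_))
    · filter_upwards [M.ae_obs_zero κ] with ω hω
      simp [hω]
    · filter_upwards [M.ae_obs_zero κ] with ω hω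
      simp [hω]
  have hPm : Measurable fun ω : PathSpace E q => ∏ i ∈ I, f i (sig i ω, obs i ω) :=
    Finset.measurable_prod _ fun i _ => (f i).continuous.measurable.comp
      ((measurable_sig i).prodMk (measurable_obs i))
  have hPi : ∀ κ, Integrable (fun ω : PathSpace E q => ∏ i ∈ I, f i (sig i ω, obs i ω))
      (M.law κ) := fun κ => integrable_of_abs_le hPm.aestronglyMeasurable
        fun ω => abs_prod_bcf_le I f _
  have hUi : ∀ κ : ProbabilityMeasure E, Integrable (fun x => U (x, 0)) (κ : Measure E) :=
    fun κ => integrable_of_abs_le (Continuous.aestronglyMeasurable (by fun_prop))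
      fun x => U.norm_coe_le_norm _
  rw [integral_smul_measure, integral_add_measure (hPi μ) (hPi ν), key, key, key,
    ← integral_add_measure (hUi μ) (hUi ν), ← h, integral_smul_measure]

lemma exists_midpoint {S : Type*} [MeasurableSpace S] (μ ν : ProbabilityMeasure S) :
    ∃ η : ProbabilityMeasure S, (2 : ℝ≥0∞) • (η : Measure S) = μ + ν := by
  refine ⟨⟨(2 : ℝ≥0∞)⁻¹ • ((μ : Measure S) + ν), ⟨?_⟩⟩, ?_⟩
  · simp [ENNReal.inv_two_add_inv_two]
  · change (2 : ℝ≥0∞) • ((2 : ℝ≥0∞)⁻¹ • ((μ : Measure S) + ν)) = _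
    rw [smul_smul, ENNReal.mul_inv_cancel (by simp) (by simp), one_smul]

/-- For any two initial laws there is a third one whose path law dominates both path laws. -/
lemma IsFeller.exists_dominating (hM : M.IsFeller) (μ ν : ProbabilityMeasure E) :
    ∃ η, M.law μ ≪ M.law η ∧ M.law ν ≪ M.law η := by
  obtain ⟨η, hη⟩ := exists_midpoint μ ν
  have h := hM.law_midpoint hη
  have h2 : (2 : ℝ≥0∞) • M.law η ≪ M.law η := Measure.smul_absolutelyContinuous
  rw [h] at h2
  exact ⟨η, (Measure.AbsolutelyContinuous.rfl.add_right _).trans h2,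
    (Measure.absolutelyContinuous_of_le (Measure.le_add_left le_rfl)).trans h2⟩

end HiddenMarkovModel

/-! ### Merging of forecasts under two observation laws -/

namespace HiddenMarkovModel

section Merging

variable {E : Type*} [TopologicalSpace E] [MeasurableSpace E] {q : ℕ} {M : HiddenMarkovModel E q}

/-- The density of the law of the observations for one initial law with respect to that for
another, as a function on path space. -/
def obsDensity (M : HiddenMarkovModel E q) (μ ν : ProbabilityMeasure E) (ω : PathSpace E q) : ℝ :=
  ((M.obsLaw μ).rnDeriv (M.obsLaw ν) ω.2).toReal

lemma isProbabilityMeasure_obsLaw (M : HiddenMarkovModel E q) (μ : ProbabilityMeasure E) :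
    IsProbabilityMeasure (M.obsLaw μ) := by
  have := M.isProbabilityMeasure_law μ
  exact Measure.isProbabilityMeasure_map measurable_snd.aemeasurable

lemma measurable_obsDensity (μ ν : ProbabilityMeasure E) :
    Measurable[MeasurableSpace.comap Prod.snd inferInstance] (M.obsDensity μ ν) :=
  (Measure.measurable_rnDeriv _ _).ennreal_toReal.comp (comap_measurable _)

lemma integrable_obsDensity (μ ν : ProbabilityMeasure E) :
    Integrable (M.obsDensity μ ν) (M.law ν) := by
  have := M.isProbabilityMeasure_obsLaw μ
  have h : Integrable (fun y => ((M.obsLaw μ).rnDeriv (M.obsLaw ν) y).toReal) (M.obsLaw ν) :=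
    Measure.integrable_toReal_rnDeriv
  exact h.comp_measurable measurable_snd

/-- Change of measure for functions of the observations. -/
lemma integral_eq_integral_obsDensity_mul {μ ν η : ProbabilityMeasure E}
    (hac : M.obsLaw μ ≪ M.obsLaw ν) (hμ : M.law μ ≪ M.law η) (hν : M.law ν ≪ M.law η)
    {Z : PathSpace E q → ℝ}
    (hZ : AEStronglyMeasurable[MeasurableSpace.comap Prod.snd inferInstance] Z (M.law η)) :
    ∫ ω, Z ω ∂(M.law μ) = ∫ ω, M.obsDensity μ ν ω * Z ω ∂(M.law ν) := by
  have := M.isProbabilityMeasure_obsLaw μ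
  have := M.isProbabilityMeasure_obsLaw ν
  obtain ⟨Z', hZ', hZZ'⟩ := hZ
  obtain ⟨k, hk, rfl⟩ := hZ'.exists_eq_measurable_comp
  rw [integral_congr_ae (hμ.ae_le hZZ')]
  have h1 : ∫ ω, (k ∘ Prod.snd) ω ∂(M.law μ) = ∫ y, k y ∂(M.obsLaw μ) :=
    (integral_map measurable_snd.aemeasurable hk.aestronglyMeasurable).symm
  have hkm : Measurable fun y => ((M.obsLaw μ).rnDeriv (M.obsLaw ν) y).toReal * k y :=
    (Measure.measurable_rnDeriv _ _).ennreal_toReal.mul hk.measurable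
  have h2 : ∫ y, ((M.obsLaw μ).rnDeriv (M.obsLaw ν) y).toReal * k y ∂(M.obsLaw ν)
      = ∫ ω, M.obsDensity μ ν ω * k ω.2 ∂(M.law ν) :=
    integral_map measurable_snd.aemeasurable hkm.aestronglyMeasurable
  rw [h1, ← integral_toReal_rnDeriv_mul hac, h2]
  refine integral_congr_ae ?_
  filter_upwards [hν.ae_le hZZ'] with ω hω
  rw [hω]; rfl

/-- Maximal inequality for the difference of two filters, evaluated at a function `u` which
predicts functionals `h` of the observations. -/
lemma maximal_inequality [OpensMeasurableSpace E] {μ ν η : ProbabilityMeasure E}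
    (hac : M.obsLaw μ ≪ M.obsLaw ν) (hμ : M.law μ ≪ M.law η) (hν : M.law ν ≪ M.law η)
    {π ρ : ℝ≥0 → PathSpace E q → ProbabilityMeasure E} (hπ : M.IsFilter μ π)
    (hρ : M.IsFilter ν ρ) {u : E →ᵇ ℝ} {h : ℝ≥0 → PathSpace E q → ℝ} {C : ℝ} (huC : ‖u‖ ≤ C)
    (hm : ∀ t, Measurable[MeasurableSpace.comap Prod.snd inferInstance] (h t))
    (hC : ∀ t ω, |h t ω| ≤ C)
    (hu : ∀ (κ : ProbabilityMeasure E) (t : ℝ≥0) (B : Set (PathSpace E q)),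
      MeasurableSet[M.augObsFiltration t] B →
      ∫ ω in B, h t ω ∂(M.law κ) = ∫ ω in B, u (sig t ω) ∂(M.law κ))
    {T : ℝ≥0} {G : PathSpace E q → ℝ} (hG : StronglyMeasurable[obsFiltration E q T] G)
    (hGi : Integrable G (M.law ν)) {J : Finset ℝ≥0} (hJ : ∀ t ∈ J, T ≤ t) (ε : ℝ) (hε : 0 ≤ ε) :
    ε * (M.law μ).real {ω | ∃ t ∈ J,
      ε < ∫ x, u x ∂(π t ω : Measure E) - ∫ x, u x ∂(ρ t ω : Measure E)}
      ≤ 2 * C * ∫ ω, |M.obsDensity μ ν ω - G ω| ∂(M.law ν) := by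
  classical
  have := M.isProbabilityMeasure_law
  let φ : ℝ≥0 → PathSpace E q → ℝ := fun t ω => ∫ x, u x ∂(π t ω : Measure E)
  let ψ : ℝ≥0 → PathSpace E q → ℝ := fun t ω => ∫ x, u x ∂(ρ t ω : Measure E)
  -- `A t` is the event that `t` is the first time in `J` at which the difference exceeds `ε`. These
  -- events are disjoint, which gives the bound on `Z` with no factor for the size of `J`.
  let A : ℝ≥0 → Set (PathSpace E q) := fun t =>
    {ω | ε < φ t ω - ψ t ω} ∩ ⋂ s ∈ J.filter (· < t), {ω | φ s ω - ψ s ω ≤ ε}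
  have hφm : ∀ t, Measurable[M.augObsFiltration t] (φ t) := fun t => hπ.measurable_integral t u
  have hψm : ∀ t, Measurable[M.augObsFiltration t] (ψ t) := fun t => hρ.measurable_integral t u
  have hdm : ∀ t, Measurable[M.augObsFiltration t] fun ω => φ t ω - ψ t ω := fun t =>
    (hφm t).sub (hψm t)
  have hA : ∀ t, MeasurableSet[M.augObsFiltration t] (A t) := fun t => by
    refine MeasurableSet.inter (hdm t measurableSet_Ioi) ?_
    refine Finset.measurableSet_biInter _ fun s hs => ?_
    exact usualAugmentation_mono_time (Finset.mem_filter.1 hs).2.le _ (hdm s measurableSet_Iic)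
  have hAnull : ∀ t κ, NullMeasurableSet (A t) (M.law κ) := fun t κ =>
    M.nullMeasurableSet_of_augObsFiltration (hA t) κ
  have hhm : ∀ t, Measurable (h t) := fun t => (hm t).mono comap_snd_le le_rfl
  have hhi : ∀ t κ, Integrable (h t) (M.law κ) := fun t κ =>
    integrable_of_abs_le (hhm t).aestronglyMeasurable (hC t)
  have hφi : ∀ t κ, Integrable (φ t) (M.law κ) := fun t κ => hπ.integrable_integral t u κ
  have hψi : ∀ t κ, Integrable (ψ t) (M.law κ) := fun t κ => hρ.integrable_integral t u κ
  have hhψi : ∀ t κ, Integrable (fun ω => h t ω - ψ t ω) (M.law κ) := fun t κ =>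
    (hhi t κ).sub (hψi t κ)
  have hdom : ∀ t ω, |h t ω - ψ t ω| ≤ 2 * C := fun t ω => by
    have h1 := abs_sub (h t ω) (ψ t ω)
    have h2 := hC t ω
    have h3 : |ψ t ω| ≤ ‖u‖ := abs_integral_bcf_le u _
    linarith
  have hC0 : 0 ≤ C := (norm_nonneg u).trans huC
  let Z : PathSpace E q → ℝ := fun ω => ∑ t ∈ J, (A t).indicator (fun ω => h t ω - ψ t ω) ω
  have hZb : ∀ ω, |Z ω| ≤ 2 * C := by
    intro ω
    by_cases hω : ∃ t ∈ J, ω ∈ A t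
    · obtain ⟨t, htJ, ht⟩ := hω
      have : Z ω = h t ω - ψ t ω := by
        refine (Finset.sum_eq_single_of_mem t htJ fun s hsJ hst => ?_).trans
          (indicator_of_mem ht _)
        refine indicator_of_notMem (fun hs => ?_) _
        rcases lt_or_gt_of_ne hst with h' | h'
        · exact not_lt.2 (show φ s ω - ψ s ω ≤ ε from
            mem_iInter₂.1 ht.2 s (Finset.mem_filter.2 ⟨hsJ, h'⟩)) hs.1
        · exact not_lt.2 (show φ t ω - ψ t ω ≤ ε from
            mem_iInter₂.1 hs.2 t (Finset.mem_filter.2 ⟨htJ, h'⟩)) ht.1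
      rw [this]; exact hdom t ω
    · push Not at hω
      have : Z ω = 0 := Finset.sum_eq_zero fun t ht => indicator_of_notMem (hω t ht) _
      rw [this, abs_zero]; positivity
  have hZi : ∀ κ, Integrable Z (M.law κ) := fun κ =>
    integrable_finsetSum _ fun t _ => (hhψi t κ).indicator₀ (hAnull t κ)
  -- Working under `η` yields one observation-measurable version of `Z` valid for both `μ` and `ν`;
  -- absolute continuity of the observation laws alone would not compare their null sets on path
  -- space.
  have hZm : AEStronglyMeasurable[MeasurableSpace.comap Prod.snd inferInstance] Z (M.law η) := by
    refine aestronglyMeasurable_of_eventuallyMeasurable ?_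
    refine Finset.measurable_fun_sum _ fun t _ => ?_
    refine Measurable.indicator ?_ (M.augObsFiltration_le_eventuallyMeasurable η t _ (hA t))
    refine Measurable.sub ((hm t).mono le_eventuallyMeasurableSpace le_rfl) ?_
    exact (hψm t).mono (M.augObsFiltration_le_eventuallyMeasurable η t) le_rfl
  have hsub : {ω | ∃ t ∈ J, ε < φ t ω - ψ t ω} ⊆ ⋃ t ∈ J, A t := by
    rintro ω ⟨t, htJ, ht⟩
    obtain ⟨s, hs, hmin⟩ := Finset.exists_min_image (J.filter fun s => ε < φ s ω - ψ s ω) id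
      ⟨t, Finset.mem_filter.2 ⟨htJ, ht⟩⟩
    rw [Finset.mem_filter] at hs
    refine mem_iUnion₂.2 ⟨s, hs.1, hs.2, mem_iInter₂.2 fun r hr => ?_⟩
    rw [Finset.mem_filter] at hr
    by_contra hr'
    exact absurd hr.2 (not_lt.2 (hmin r (Finset.mem_filter.2 ⟨hr.1, not_le.1 hr'⟩)))
  -- `G` is known at time `T ≤ t`, while `h t - ψ t` is a forecast error under `ν`, orthogonal to
  -- everything observed by time `t`.
  have hGZ : ∫ ω, G ω * Z ω ∂(M.law ν) = 0 := by
    have e : ∀ ω, G ω * Z ω = ∑ t ∈ J, (A t).indicator (fun ω => G ω * (h t ω - ψ t ω)) ω := by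
      intro ω
      simp only [Z, Finset.mul_sum]
      refine Finset.sum_congr rfl fun t _ => ?_
      by_cases ht : ω ∈ A t <;> simp [ht]
    have hGi' : ∀ t, Integrable (fun ω => G ω * (h t ω - ψ t ω)) (M.law ν) := fun t =>
      hGi.mul_of_top_left (memLp_top_of_bound (hhψi t ν).aestronglyMeasurable (2 * C)
        (Eventually.of_forall (hdom t)))
    simp_rw [e]
    rw [integral_finsetSum _ fun t _ => (hGi' t).indicator₀ (hAnull t ν)]
    refine Finset.sum_eq_zero fun t ht => ?_
    rw [integral_indicator₀ (hAnull t ν)]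
    have hle : obsFiltration E q T ≤ obsFiltration E q t := obsFiltration_mono (hJ t ht)
    refine integral_mul_eq_zero_of_forall_setIntegral_eq_zero
      ((obsFiltration_le_comap t).trans comap_snd_le) (hG.mono hle) (hhψi t ν).integrableOn
      (hGi' t).integrableOn fun D hD => ?_
    have hD' := le_usualAugmentation (P := M.law) obsFiltration_mono t _ hD
    have hDA := MeasurableSet.inter hD' (hA t)
    rw [Measure.restrict_restrict ((obsFiltration_le_comap t).trans comap_snd_le _ hD),
      integral_sub (hhi t ν).integrableOn (hψi t ν).integrableOn, hu ν t _ hDA,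
      hρ.setIntegral_eq t u hDA, sub_self]
  -- Under `μ` the forecast of the same `h t` is `φ t`, so it may replace `h t` on `A t`.
  have hZQ : ∑ t ∈ J, ∫ ω in A t, (φ t ω - ψ t ω) ∂(M.law μ) = ∫ ω, Z ω ∂(M.law μ) := by
    rw [integral_finsetSum _ fun t _ => (hhψi t μ).indicator₀ (hAnull t μ)]
    refine Finset.sum_congr rfl fun t _ => ?_
    rw [integral_indicator₀ (hAnull t μ), integral_sub (hφi t μ).integrableOn
      (hψi t μ).integrableOn, integral_sub (hhi t μ).integrableOn (hψi t μ).integrableOn,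
      hu μ t _ (hA t), hπ.setIntegral_eq t u (hA t)]
  have hΛi := M.integrable_obsDensity μ ν
  have hZtop : MemLp Z ⊤ (M.law ν) :=
    memLp_top_of_bound (hZi ν).aestronglyMeasurable (2 * C) (Eventually.of_forall hZb)
  calc ε * (M.law μ).real {ω | ∃ t ∈ J, ε < φ t ω - ψ t ω}
      ≤ ε * ∑ t ∈ J, (M.law μ).real (A t) :=
        mul_le_mul_of_nonneg_left ((measureReal_mono hsub (measure_ne_top _ _)).trans
          (measureReal_biUnion_finset_le _ _)) hε
    _ = ∑ t ∈ J, ∫ ω in A t, ε ∂(M.law μ) := by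
        rw [Finset.mul_sum]
        refine Finset.sum_congr rfl fun t _ => ?_
        rw [setIntegral_const, smul_eq_mul, mul_comm]
    _ ≤ ∑ t ∈ J, ∫ ω in A t, (φ t ω - ψ t ω) ∂(M.law μ) := by
        refine Finset.sum_le_sum fun t _ => ?_
        refine setIntegral_mono_on₀ (integrable_const _).integrableOn
          ((hφi t μ).sub (hψi t μ)).integrableOn (hAnull t μ) fun ω hω => hω.1.le
    _ = ∫ ω, M.obsDensity μ ν ω * Z ω ∂(M.law ν) := by
        rw [hZQ, integral_eq_integral_obsDensity_mul hac hμ hν hZm]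
    _ = ∫ ω, (M.obsDensity μ ν ω - G ω) * Z ω ∂(M.law ν) := by
        have h1 : Integrable (fun ω => M.obsDensity μ ν ω * Z ω) (M.law ν) :=
          hΛi.mul_of_top_left hZtop
        have h2 : Integrable (fun ω => G ω * Z ω) (M.law ν) := hGi.mul_of_top_left hZtop
        simp_rw [sub_mul]
        rw [integral_sub h1 h2, hGZ, sub_zero]
    _ ≤ ∫ ω, 2 * C * |M.obsDensity μ ν ω - G ω| ∂(M.law ν) := by
        refine integral_mono ((hΛi.sub hGi).mul_of_top_left hZtop)
          ((hΛi.sub hGi).abs.const_mul _) fun ω => ?_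
        refine (le_abs_self _).trans ?_
        dsimp only
        rw [abs_mul, mul_comm]
        exact mul_le_mul_of_nonneg_right (hZb ω) (abs_nonneg _)
    _ = _ := integral_const_mul _ _

lemma IsFilter.continuousWithinAt_integral [OpensMeasurableSpace E] {μ : ProbabilityMeasure E}
    {π : ℝ≥0 → PathSpace E q → ProbabilityMeasure E} (hπ : M.IsFilter μ π) (u : E →ᵇ ℝ)
    (ω : PathSpace E q) (t : ℝ≥0) :
    ContinuousWithinAt (fun t => ∫ x, u x ∂(π t ω : Measure E)) (Ioi t) t :=
  ProbabilityMeasure.tendsto_iff_forall_integral_tendsto.1 (hπ.cadlag ω t).1 u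

/-- The density of the law of the observations can be approximated by functions of the
observations up to a finite time. -/
lemma exists_approx_obsDensity (μ ν : ProbabilityMeasure E) {δ : ℝ} (hδ : 0 < δ) :
    ∃ (n : ℕ) (G : PathSpace E q → ℝ), StronglyMeasurable[obsFiltration E q n] G ∧
      Integrable G (M.law ν) ∧ ∫ ω, |M.obsDensity μ ν ω - G ω| ∂(M.law ν) < δ := by
  have := M.isProbabilityMeasure_law ν
  let ℱ : Filtration ℕ (inferInstance : MeasurableSpace (PathSpace E q)) :=
    ⟨fun n => obsFiltration E q n, fun n k hnk => obsFiltration_mono (by exact_mod_cast hnk),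
      fun n => (obsFiltration_le_comap _).trans comap_snd_le⟩
  have hsup : ⨆ n, ℱ n = MeasurableSpace.comap Prod.snd inferInstance := iSup_obsFiltration_nat
  have hΛ : StronglyMeasurable[⨆ n, ℱ n] (M.obsDensity μ ν) := by
    rw [hsup]
    exact (measurable_obsDensity μ ν).stronglyMeasurable
  -- Lévy's upward theorem in `L¹`.
  have hlim := (M.integrable_obsDensity μ ν).tendsto_eLpNorm_condExp hΛ
  obtain ⟨n, hn⟩ := (hlim.eventually (gt_mem_nhds (ENNReal.ofReal_pos.2 hδ))).exists
  refine ⟨n, (M.law ν)[M.obsDensity μ ν | ℱ n], stronglyMeasurable_condExp, integrable_condExp, ?_⟩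
  rw [eLpNorm_sub_comm, eLpNorm_one_eq_lintegral_enorm] at hn
  have hi : Integrable (fun ω => M.obsDensity μ ν ω - ((M.law ν)[M.obsDensity μ ν | ℱ n]) ω)
      (M.law ν) := (M.integrable_obsDensity μ ν).sub integrable_condExp
  have := integral_norm_eq_lintegral_enorm hi.aestronglyMeasurable
  simp only [Real.norm_eq_abs] at this
  rw [this]
  exact (ENNReal.lt_ofReal_iff_toReal_lt hn.ne_top).1 hn

/-- Exceedances after time `n` have probability at most a multiple of the `L¹` error in
approximating the density from observations up to `n`, and this error can be made arbitrarily small.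
-/
lemma IsFilter.ae_eventually_sub_le [OpensMeasurableSpace E] {μ ν η : ProbabilityMeasure E}
    (hac : M.obsLaw μ ≪ M.obsLaw ν) (hμ : M.law μ ≪ M.law η) (hν : M.law ν ≪ M.law η)
    {π ρ : ℝ≥0 → PathSpace E q → ProbabilityMeasure E} (hπ : M.IsFilter μ π)
    (hρ : M.IsFilter ν ρ) {u : E →ᵇ ℝ} {h : ℝ≥0 → PathSpace E q → ℝ} {C : ℝ} (huC : ‖u‖ ≤ C)
    (hm : ∀ t, Measurable[MeasurableSpace.comap Prod.snd inferInstance] (h t))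
    (hC : ∀ t ω, |h t ω| ≤ C)
    (hu : ∀ (κ : ProbabilityMeasure E) (t : ℝ≥0) (B : Set (PathSpace E q)),
      MeasurableSet[M.augObsFiltration t] B →
      ∫ ω in B, h t ω ∂(M.law κ) = ∫ ω in B, u (sig t ω) ∂(M.law κ)) {ε : ℝ} (hε : 0 < ε) :
    ∀ᵐ ω ∂(M.law μ), ∀ᶠ t in atTop,
      ∫ x, u x ∂(π t ω : Measure E) - ∫ x, u x ∂(ρ t ω : Measure E) ≤ ε := by
  have := M.isProbabilityMeasure_law μ
  let d : ℝ≥0 → PathSpace E q → ℝ := fun t ω =>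
    ∫ x, u x ∂(π t ω : Measure E) - ∫ x, u x ∂(ρ t ω : Measure E)
  let S : ℕ → Set (PathSpace E q) := fun n => {ω | ∃ t : ℝ≥0, n ≤ t ∧ ε < d t ω}
  have hC0 : 0 ≤ C := (norm_nonneg u).trans huC
  -- By right-continuity an exceedance persists on an interval to the right of its time, which
  -- contains a point of the dense sequence.
  have hcover : ∀ n, S n ⊆ ⋃ k : ℕ, {ω | ∃ t ∈ (Finset.image (TopologicalSpace.denseSeq ℝ≥0)
      (Finset.range k)).filter ((n : ℝ≥0) ≤ ·), ε < d t ω} := by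
    rintro n ω ⟨t, hnt, ht⟩
    have hc : ContinuousWithinAt (fun t => d t ω) (Ioi t) t :=
      (hπ.continuousWithinAt_integral u ω t).sub (hρ.continuousWithinAt_integral u ω t)
    obtain ⟨b, hb, hsub⟩ := mem_nhdsGT_iff_exists_Ioo_subset.1 (hc.eventually (lt_mem_nhds ht))
    obtain ⟨_, ⟨k, rfl⟩, hk⟩ :=
      (TopologicalSpace.denseRange_denseSeq ℝ≥0).exists_between (show t < b from hb)
    refine mem_iUnion.2 ⟨k + 1, TopologicalSpace.denseSeq ℝ≥0 k, ?_, hsub hk⟩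
    exact Finset.mem_filter.2 ⟨Finset.mem_image_of_mem _ (by simp), hnt.trans hk.1.le⟩
  have hS : ∀ δ : ℝ, 0 < δ → M.law μ (⋂ n, S n) ≤ ENNReal.ofReal δ := by
    intro δ hδ
    obtain ⟨n, G, hG, hGi, hGδ⟩ := M.exists_approx_obsDensity μ ν
      (show 0 < ε * δ / (2 * C + 1) by positivity)
    refine (measure_mono ((iInter_subset S n).trans (hcover n))).trans ?_
    rw [Monotone.measure_iUnion]
    · refine iSup_le fun k => ?_
      have hmax := maximal_inequality hac hμ hν hπ hρ huC hm hC hu hG hGi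
        (J := (Finset.image (TopologicalSpace.denseSeq ℝ≥0) (Finset.range k)).filter
          ((n : ℝ≥0) ≤ ·)) (fun t ht => (Finset.mem_filter.1 ht).2) ε hε.le
      refine (ENNReal.le_ofReal_iff_toReal_le (measure_ne_top _ _) hδ.le).2 ?_
      refine le_of_mul_le_mul_left (hmax.trans ?_) hε
      calc 2 * C * ∫ ω, |M.obsDensity μ ν ω - G ω| ∂(M.law ν)
          ≤ (2 * C + 1) * (ε * δ / (2 * C + 1)) :=
            mul_le_mul (by linarith) hGδ.le (integral_nonneg fun _ => abs_nonneg _) (by positivity)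
        _ = ε * δ := by field_simp
    · intro k l hkl ω ⟨t, ht, htd⟩
      refine ⟨t, ?_, htd⟩
      rw [Finset.mem_filter] at ht ⊢
      exact ⟨Finset.image_subset_image (Finset.range_mono hkl) ht.1, ht.2⟩
  have h0 : M.law μ (⋂ n, S n) = 0 := by
    refine le_antisymm (ENNReal.le_of_forall_pos_le_add fun δ hδ _ => ?_) zero_le
    simpa using hS δ hδ
  have h0' : ∀ᵐ ω ∂(M.law μ), ω ∉ ⋂ n, S n := measure_eq_zero_iff_ae_notMem.1 h0
  filter_upwards [h0'] with ω hω
  simp only [mem_iInter, not_forall] at hω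
  obtain ⟨n, hn⟩ := hω
  filter_upwards [eventually_ge_atTop (n : ℝ≥0)] with t ht
  by_contra hlt
  exact hn ⟨t, ht, not_le.1 hlt⟩

/-- The filters for two initial laws merge when they are evaluated at a function which predicts
functionals of the observations. -/
lemma IsFilter.ae_tendsto_integral_sub [OpensMeasurableSpace E] {μ ν η : ProbabilityMeasure E}
    (hac : M.obsLaw μ ≪ M.obsLaw ν) (hμ : M.law μ ≪ M.law η) (hν : M.law ν ≪ M.law η)
    {π ρ : ℝ≥0 → PathSpace E q → ProbabilityMeasure E} (hπ : M.IsFilter μ π)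
    (hρ : M.IsFilter ν ρ) {u : E →ᵇ ℝ} {h : ℝ≥0 → PathSpace E q → ℝ} {C : ℝ}
    (hm : ∀ t, Measurable[MeasurableSpace.comap Prod.snd inferInstance] (h t))
    (hC : ∀ t ω, |h t ω| ≤ C)
    (hu : ∀ (κ : ProbabilityMeasure E) (t : ℝ≥0) (B : Set (PathSpace E q)),
      MeasurableSet[M.augObsFiltration t] B →
      ∫ ω in B, h t ω ∂(M.law κ) = ∫ ω in B, u (sig t ω) ∂(M.law κ)) :
    ∀ᵐ ω ∂(M.law μ), Tendsto (fun t =>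
      ∫ x, u x ∂(π t ω : Measure E) - ∫ x, u x ∂(ρ t ω : Measure E)) atTop (𝓝 0) := by
  have h1 : ∀ n : ℕ, _ := fun n => hπ.ae_eventually_sub_le hac hμ hν hρ (le_max_left ‖u‖ C) hm
    (fun t ω => (hC t ω).trans (le_max_right _ _)) hu (Nat.one_div_pos_of_nat (α := ℝ) (n := n))
  -- The lower bound is the upper bound for `-u`, which predicts `-h`.
  have h2 : ∀ n : ℕ, _ := fun n => hπ.ae_eventually_sub_le (u := -u) (h := fun t ω => -h t ω)
    hac hμ hν hρ ((norm_neg u).le.trans (le_max_left ‖u‖ C)) (fun t => (hm t).neg)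
    (fun t ω => (abs_neg (h t ω)).le.trans ((hC t ω).trans (le_max_right _ _)))
    (fun κ t B hB => by
      simp only [BoundedContinuousFunction.coe_neg, Pi.neg_apply, integral_neg, hu κ t B hB])
    (Nat.one_div_pos_of_nat (α := ℝ) (n := n))
  filter_upwards [ae_all_iff.2 h1, ae_all_iff.2 h2] with ω h1 h2
  rw [Metric.tendsto_nhds]
  intro ε hε
  obtain ⟨n, hn⟩ := exists_nat_one_div_lt hε
  filter_upwards [h1 n, h2 n] with t h1 h2
  simp only [BoundedContinuousFunction.coe_neg, Pi.neg_apply, integral_neg] at h2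
  rw [Real.dist_eq, sub_zero, abs_lt]
  constructor <;> linarith

end Merging

end HiddenMarkovModel

/-! ### Bounded-Lipschitz and total variation distances -/

section BoundedLipschitz

variable {E : Type*} [MetricSpace E]

lemma totallyBounded_lipUnitBall [CompactSpace E] :
    TotallyBounded {f : E →ᵇ ℝ | ⇑f ∈ lipUnitBall E} := by
  refine (BoundedContinuousFunction.arzela_ascoli (Icc (-1 : ℝ) 1) isCompact_Icc _
    (fun f x hf => abs_le.1 (hf.1 x)) ?_).totallyBounded.subset subset_closure
  exact (LipschitzWith.uniformEquicontinuous _ 1 fun f => f.2.2).equicontinuous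

variable [MeasurableSpace E] [BorelSpace E]

lemma abs_integral_sub_integral_le (f g : E →ᵇ ℝ) (μ : Measure E) [IsProbabilityMeasure μ] :
    |∫ x, f x ∂μ - ∫ x, g x ∂μ| ≤ dist f g := by
  have hi : ∀ k : E →ᵇ ℝ, Integrable k μ := fun k =>
    integrable_of_abs_le k.continuous.aestronglyMeasurable k.norm_coe_le_norm
  rw [← integral_sub (hi f) (hi g), dist_eq_norm]
  exact HiddenMarkovModel.abs_integral_bcf_le (f - g) μ

/-- The dual bounded-Lipschitz distance of two families which converge weakly to the same limit
tends to zero. -/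
lemma tendsto_blDist_zero [CompactSpace E] {ι : Type*} {l : Filter ι}
    {μ ν : ι → ProbabilityMeasure E} {κ : ProbabilityMeasure E} (hμ : Tendsto μ l (𝓝 κ)) (hν : Tendsto ν l (𝓝 κ)) :
    Tendsto (fun i => blDist (μ i : Measure E) (ν i : Measure E)) l (𝓝 0) := by
  rw [ProbabilityMeasure.tendsto_iff_forall_integral_tendsto] at hμ hν
  rw [Metric.tendsto_nhds]
  intro ε hε
  -- A finite net reduces the supremum to finitely many test functions: two net errors and one weak
  -- convergence error give `3 * (ε / 4) < ε`.
  obtain ⟨N, hN, hcov⟩ := Metric.totallyBounded_iff.1 (totallyBounded_lipUnitBall (E := E))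
    (ε / 4) (by positivity)
  have hev : ∀ᶠ i in l, ∀ g ∈ N,
      |∫ x, g x ∂(μ i : Measure E) - ∫ x, g x ∂(ν i : Measure E)| < ε / 4 := by
    refine (eventually_all_finite hN).2 fun g _ => ?_
    have h0 := (hμ g).sub (hν g)
    rw [sub_self] at h0
    have := (Metric.tendsto_nhds.1 h0) (ε / 4) (by positivity)
    simpa only [Real.dist_eq, sub_zero] using this
  filter_upwards [hev] with i hi
  have h0 : 0 ≤ blDist (μ i : Measure E) (ν i : Measure E) := by
    refine Real.sSup_nonneg ?_
    rintro _ ⟨g, _, rfl⟩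
    exact abs_nonneg _
  have hle : blDist (μ i : Measure E) (ν i : Measure E) ≤ 3 * (ε / 4) := by
    refine Real.sSup_le ?_ (by positivity)
    rintro _ ⟨f, hf, rfl⟩
    let F : E →ᵇ ℝ := BoundedContinuousFunction.ofNormedAddCommGroup f hf.2.continuous 1 hf.1
    obtain ⟨g, hg, hFg⟩ := mem_iUnion₂.1 (hcov (show F ∈ _ from hf))
    have h1 := (abs_integral_sub_integral_le F g (μ i : Measure E)).trans_lt hFg
    have h2 := (abs_integral_sub_integral_le F g (ν i : Measure E)).trans_lt hFg
    have h3 := hi g hg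
    change |∫ x, F x ∂(μ i : Measure E) - ∫ x, F x ∂(ν i : Measure E)| ≤ _
    rw [abs_lt] at h1 h2 h3
    rw [abs_le]
    constructor <;> linarith
  rw [Real.dist_eq, sub_zero, abs_of_nonneg h0]
  linarith

end BoundedLipschitz

lemma abs_integral_sub_le_tvDist {S : Type*} [MeasurableSpace S] (P Q : Measure S)
    [IsProbabilityMeasure P] [IsProbabilityMeasure Q] {f : S → ℝ} (hf : Measurable f) {C : ℝ}
    (hC : ∀ x, |f x| ≤ C) (hC0 : 0 ≤ C) :
    |∫ x, f x ∂P - ∫ x, f x ∂Q| ≤ (C + 1) * tvDist P Q := by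
  have hC1 : 0 < C + 1 := by linarith
  -- Dividing by `C + 1` rather than `C` covers `C = 0`.
  have hmem : (fun x => f x / (C + 1)) ∈ {g : S → ℝ | Measurable g ∧ ∀ x, |g x| ≤ 1} := by
    refine ⟨hf.div_const _, fun x => ?_⟩
    rw [abs_div, abs_of_pos hC1, div_le_one hC1]
    exact (hC x).trans (by linarith)
  have hbdd : BddAbove ((fun g : S → ℝ => |∫ x, g x ∂P - ∫ x, g x ∂Q|) ''
      {g : S → ℝ | Measurable g ∧ ∀ x, |g x| ≤ 1}) := by
    refine ⟨2, ?_⟩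
    rintro _ ⟨g, hg, rfl⟩
    have h1 : ∀ κ : Measure S, IsProbabilityMeasure κ → |∫ x, g x ∂κ| ≤ 1 := fun κ _ => by
      have := norm_integral_le_of_norm_le_const (μ := κ) (f := g) (C := 1)
        (Eventually.of_forall hg.2)
      simpa using this
    have := abs_sub (∫ x, g x ∂P) (∫ x, g x ∂Q)
    have := h1 P inferInstance
    have := h1 Q inferInstance
    dsimp only
    linarith
  have := le_csSup hbdd (mem_image_of_mem _ hmem)
  rw [integral_div, integral_div, ← sub_div, abs_div, abs_of_pos hC1, div_le_iff₀ hC1] at this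
  rw [mul_comm]
  exact this

/-! ### Predictions, uniform observability and stability -/

namespace HiddenMarkovModel

variable {E : Type*} [MetricSpace E] [CompactSpace E] [MeasurableSpace E] [BorelSpace E] {q : ℕ}
  {M : HiddenMarkovModel E q}

/-- The bounded continuous function `u` of the signal gives the conditional expectation of the
product functional `∏ g i (Y_i)`, `i ∈ I`, of the observations. -/
structure IsPrediction (M : HiddenMarkovModel E q) (I : Finset ℝ≥0)
    (g : ℝ≥0 → (ObsSpace q →ᵇ ℝ)) (u : E →ᵇ ℝ) : Prop where
  future : ∀ (κ : ProbabilityMeasure E) (t : ℝ≥0) (B : Set (PathSpace E q)),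
    MeasurableSet[M.augObsFiltration t] B →
    ∫ ω in B, ∏ i ∈ I, g i (obs (t + i) ω - obs t ω) ∂(M.law κ)
      = ∫ ω in B, u (sig t ω) ∂(M.law κ)
  obsLaw : ∀ κ : ProbabilityMeasure E,
    ∫ y, ∏ i ∈ I, g i (y.coord i) ∂(M.obsLaw κ) = ∫ x, u x ∂(κ : Measure E)

lemma measurable_prod_coord (I : Finset ℝ≥0) (g : ℝ≥0 → (ObsSpace q →ᵇ ℝ)) :
    Measurable fun y : CadlagPath (ObsSpace q) => ∏ i ∈ I, g i (y.coord i) :=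
  Finset.measurable_prod _ fun i _ =>
    (g i).continuous.measurable.comp (CadlagPath.measurable_coord i)

/-- With starting time `a = 0` the current increment is zero, so only `U (x, 0)` matters. The second
field is the first at `t = 0` on the whole space, since `Y_0 = 0` almost surely. -/
lemma IsFeller.exists_isPrediction (hM : M.IsFeller) (I : Finset ℝ≥0)
    (g : ℝ≥0 → (ObsSpace q →ᵇ ℝ)) : ∃ u, M.IsPrediction I g u := by
  obtain ⟨U, hU⟩ := hM.exists_setIntegral_prod_eq
    (fun i => (g i).compContinuous ⟨Prod.snd, continuous_snd⟩) I 0 fun i _ => zero_le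
  let u : E →ᵇ ℝ := U.compContinuous ⟨fun x => (x, 0), by fun_prop⟩
  have hfut : ∀ (κ : ProbabilityMeasure E) (t : ℝ≥0) (B : Set (PathSpace E q)),
      MeasurableSet[M.augObsFiltration t] B →
      ∫ ω in B, ∏ i ∈ I, g i (obs (t + i) ω - obs t ω) ∂(M.law κ)
        = ∫ ω in B, u (sig t ω) ∂(M.law κ) := by
    intro κ t B hB
    have hB' := M.augObsFiltration_le_pair t _ hB
    rw [← add_zero t] at hB'
    have := hU κ t B hB'
    simp only [add_zero, sub_self] at this
    exact this
  refine ⟨u, hfut, fun κ => ?_⟩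
  have h1 := hfut κ 0 univ MeasurableSet.univ
  simp only [Measure.restrict_univ, zero_add] at h1
  rw [HiddenMarkovModel.obsLaw, integral_map measurable_snd.aemeasurable
    (measurable_prod_coord I g).aestronglyMeasurable]
  have hu : IsBoundedMeasurable fun p : E × ObsSpace q => u p.1 :=
    ⟨u.continuous.measurable.comp measurable_fst, ‖u‖, fun p => u.norm_coe_le_norm _⟩
  have h2 := M.marginal κ 0 _ hu
  have h3 : ∀ p : E × ObsSpace q, kernelOp (M.trans 0) (fun p => u p.1) p = u p.1 := fun p => by
    rw [kernelOp, M.trans_zero, Kernel.id_apply, integral_dirac' _ _ hu.1.stronglyMeasurable]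
  simp_rw [h3] at h2
  rw [← h2, ← h1]
  refine integral_congr_ae ?_
  filter_upwards [M.ae_obs_zero κ] with ω hω
  simp only [hω, sub_zero]
  rfl

/-- For an observable Feller model, initial laws merge if their integrals of all predictions of
functionals of the observations do. -/
lemma IsFeller.tendsto_blDist_of_predictions (hM : M.IsFeller) (hobs : M.Observable)
    {ι : Type*} {l : Filter ι} {μ ν : ι → ProbabilityMeasure E}
    (h : ∀ I g u, M.IsPrediction I g u → Tendsto (fun i =>
      ∫ x, u x ∂(μ i : Measure E) - ∫ x, u x ∂(ν i : Measure E)) l (𝓝 0)) :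
    Tendsto (fun i => blDist (μ i : Measure E) (ν i : Measure E)) l (𝓝 0) := by
  -- Ultrafilters give limits of both families at once for an arbitrary `l`, covering sequences of
  -- laws as well as continuous time.
  rw [tendsto_iff_ultrafilter]
  intro F hF
  obtain ⟨μ', -, hμ'⟩ := isCompact_univ.ultrafilter_le_nhds' (F.map μ) univ_mem
  obtain ⟨ν', -, hν'⟩ := isCompact_univ.ultrafilter_le_nhds' (F.map ν) univ_mem
  have hμ : Tendsto μ F (𝓝 μ') := hμ'
  have hν : Tendsto ν F (𝓝 ν') := hν'
  have heq : μ' = ν' := by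
    have := M.isProbabilityMeasure_obsLaw
    refine hobs μ' ν' (ext_of_forall_integral_prod_process CadlagPath.coord rfl fun I g => ?_)
    obtain ⟨u, hu⟩ := hM.exists_isPrediction I g
    rw [hu.obsLaw, hu.obsLaw]
    have h1 := ProbabilityMeasure.tendsto_iff_forall_integral_tendsto.1 hμ u
    have h2 := ProbabilityMeasure.tendsto_iff_forall_integral_tendsto.1 hν u
    exact sub_eq_zero.1 (tendsto_nhds_unique (h1.sub h2) ((h I g u hu).mono_left hF))
  exact tendsto_blDist_zero hμ (heq ▸ hν)

/-- An observable Feller model with compact signal state space is uniformly observable. -/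
theorem IsFeller.uniformlyObservable (hM : M.IsFeller) (hobs : M.Observable) :
    M.UniformlyObservable := by
  intro μ ν htv
  refine hM.tendsto_blDist_of_predictions hobs fun I g u hu => ?_
  have := M.isProbabilityMeasure_obsLaw
  have hbound : ∀ n, |∫ x, u x ∂(μ n : Measure E) - ∫ x, u x ∂(ν n : Measure E)|
      ≤ (∏ i ∈ I, ‖g i‖ + 1) * tvDist (M.obsLaw (μ n)) (M.obsLaw (ν n)) := fun n => by
    rw [← hu.obsLaw, ← hu.obsLaw]
    exact abs_integral_sub_le_tvDist _ _ (measurable_prod_coord I g)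
      (fun y => abs_prod_bcf_le I g _) (Finset.prod_nonneg fun _ _ => norm_nonneg _)
  refine squeeze_zero_norm hbound ?_
  simpa using htv.const_mul (∏ i ∈ I, ‖g i‖ + 1)

/-- The filter of an observable Feller model with compact signal state space is stable. -/
theorem IsFeller.ae_tendsto_blDist_filter (hM : M.IsFeller) (hobs : M.Observable)
    {μ ν : ProbabilityMeasure E} (hac : M.obsLaw μ ≪ M.obsLaw ν)
    {π ρ : ℝ≥0 → PathSpace E q → ProbabilityMeasure E} (hπ : M.IsFilter μ π)
    (hρ : M.IsFilter ν ρ) :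
    ∀ᵐ ω ∂(M.law μ), Tendsto (fun t : ℝ≥0 => blDist (π t ω : Measure E) (ρ t ω : Measure E))
      atTop (𝓝 0) := by
  obtain ⟨η, hη⟩ := hM.exists_dominating μ ν
  have : SecondCountableTopology (E →ᵇ ℝ) :=
    (ContinuousMap.isometryEquivBoundedOfCompact E ℝ).symm.toHomeomorph.secondCountableTopology
  obtain ⟨D, hDc, hD⟩ :=
    TopologicalSpace.exists_countable_dense {u : E →ᵇ ℝ // ∃ I g, M.IsPrediction I g u}
  have hae : ∀ᵐ ω ∂(M.law μ), ∀ u ∈ D, Tendsto (fun t =>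
      ∫ x, u.1 x ∂(π t ω : Measure E) - ∫ x, u.1 x ∂(ρ t ω : Measure E)) atTop (𝓝 0) := by
    refine (ae_ball_iff hDc).2 fun u _ => ?_
    obtain ⟨I, g, hu⟩ := u.2
    refine hπ.ae_tendsto_integral_sub hac hη.1 hη.2 hρ
      (h := fun t ω => ∏ i ∈ I, g i (obs (t + i) ω - obs t ω)) (fun t => ?_)
      (fun t ω => abs_prod_bcf_le I g _) hu.future
    refine Finset.measurable_prod _ fun i _ => (g i).continuous.measurable.comp ?_
    exact ((CadlagPath.measurable_coord _).sub (CadlagPath.measurable_coord _)).comp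
      (comap_measurable _)
  filter_upwards [hae] with ω hω
  -- From here `ω` is fixed and the argument is deterministic; density of `D` in the set of
  -- predictions passes convergence to all of them.
  refine hM.tendsto_blDist_of_predictions hobs fun I g v hv => ?_
  rw [Metric.tendsto_nhds]
  intro ε hε
  obtain ⟨u, huD, huv⟩ := Metric.dense_iff.1 hD ⟨v, I, g, hv⟩ (ε / 3) (by positivity)
  have huv' : dist v u.1 < ε / 3 := by
    rw [dist_comm]; exact huD
  filter_upwards [(Metric.tendsto_nhds.1 (hω u huv)) (ε / 3) (by positivity)] with t ht
  have h1 := (abs_integral_sub_integral_le v u.1 (π t ω : Measure E)).trans_lt huv'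
  have h2 := (abs_integral_sub_integral_le v u.1 (ρ t ω : Measure E)).trans_lt huv'
  rw [Real.dist_eq, sub_zero] at ht ⊢
  rw [abs_lt] at h1 h2 ht ⊢
  constructor <;> linarith

end HiddenMarkovModel

end HMM

end

theorem proposition3p5 {E : Type*} [MetricSpace E] [CompactSpace E] [MeasurableSpace E]
    [BorelSpace E] {q : ℕ} (M : HMM.HiddenMarkovModel E q) (hFeller : M.IsFeller)
    (hobs : M.Observable) :
    M.UniformlyObservable ∧
      ∀ μ ν : ProbabilityMeasure E, M.obsLaw μ ≪ M.obsLaw ν →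
        ∀ π ρ : ℝ≥0 → HMM.PathSpace E q → ProbabilityMeasure E,
          M.IsFilter μ π → M.IsFilter ν ρ →
            ∀ᵐ ω ∂(M.law μ),
              Tendsto (fun t : ℝ≥0 => HMM.blDist (π t ω : Measure E) (ρ t ω : Measure E))
                atTop (𝓝 0) := ⟨hFeller.uniformlyObservable hobs, fun _ _ hac _ _ hπ hρ =>
    hFeller.ae_tendsto_blDist_filter hobs hac hπ hρ⟩
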